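/- Let $P$ be a finite set of $n$ points in the Euclidean plane, no two of which lie on a line parallel to a direction at an angle that is a multiple of $\pi/3$ with the $x$-axis. Around every $u\in P$ the plane is divided into six cones by the rays from $u$ at the multiples of $\pi/3$. In counterclockwise order from the positive $x$-axis they are called $\overline C_1,C_0,\overline C_2,C_1,\overline C_0,C_2$; the cones $C_i$ are positive, and the opposite cones $\overline C_i$ are negative. In the half-$\theta_6$-graph on $P$ each $u\in P$ is joined, in each of its positive cones that contains a point of $P$, to the point whose projection on the bisector of the cone is closest to $u$. The subgraph $G_{12}$ has the same vertices; of the half-$\theta_6$-edges at a vertex $v$ to neighbours in a given negative cone of $v$ it keeps only the first and the last one in clockwise order around $v$ and the one to the neighbour whose projection on the bisector of the cone is closest to $v$ (every edge lies in a negative cone of exactly one of its endpoints). A deterministic $1$-local $m$-memory routing algorithm is a function that takes the current vertex $s$, the destination $t$, the set of vertices reachable from $s$ by at most one edge, and the contents of $m$ memory units carried with the message (all zero at the start), and returns the next vertex, to which the message is forwarded along an edge, and the new contents of the memory. At all times until the message arrives, each memory unit holds either one of the integers $0,\dots,n-1$ or the position of a vertex. Theorem. There are a constant $m$ and a single deterministic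 $1$-local $m$-memory routing algorithm, both independent of $P$, such that for every $P$ as above and all $u,w\in P$ with $w$ in a positive cone of $u$, routing on $G_{12}$: (i) the message from $u$ to $w$ arrives at $w$ after finitely many steps and travels a total distance of at most $38\,|uw|$; (ii) the message from $w$ to $u$ arrives at $u$ after finitely many steps and travels a total distance of at most $19\cdot\frac{5}{\sqrt3}\,|uw|$. That is, the routing ratio on $G_{12}$ is at most $38$ toward a vertex in a positive cone and at most $19\cdot 5/\sqrt3\approx 54.85$ toward a vertex in a negative cone. -/

import Mathlib

noncomputable section

/-- The Euclidean plane. -/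
abbrev Plane : Type := EuclideanSpace ℝ (Fin 2)

/-- The unit vector at angle `θ` from the positive `x`-axis. -/
def unitDir (θ : ℝ) : Plane := !₂[Real.cos θ, Real.sin θ]

/-- The `k`-th of the six (closed) cones with apex `u`, in counterclockwise order: the region between
the rays from `u` at angles `k * π / 3` and `(k + 1) * π / 3`, without the apex. -/
def coneAt (k : ℕ) (u : Plane) : Set Plane :=
  {v | v ≠ u ∧ ∃ a b : ℝ, 0 ≤ a ∧ 0 ≤ b ∧
    v - u = a • unitDir (k * Real.pi / 3) + b • unitDir ((k + 1) * Real.pi / 3)}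

/-- The positive cone `C_i` with apex `u`. -/
def positiveCone (i : Fin 3) (u : Plane) : Set Plane := coneAt (2 * i.val + 1) u

/-- The negative cone with apex `u` that is opposite to `C_i`. -/
def negativeCone (i : Fin 3) (u : Plane) : Set Plane := coneAt (2 * i.val + 4) u

/-- The unit vector along the bisector of the positive cone `C_i`; the bisector of the opposite
negative cone points in direction `- bisector i`. -/
def bisector (i : Fin 3) : Plane := unitDir ((2 * i.val + 1) * Real.pi / 3 + Real.pi / 6)

/-- No two points lie on a line parallel to a cone boundary. -/
def GeneralPosition (P : Finset Plane) : Prop :=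
  ∀ u ∈ P, ∀ v ∈ P, u ≠ v → ∀ (k : ℕ) (c : ℝ), v - u ≠ c • unitDir (k * Real.pi / 3)

/-- `v` is the closest vertex to `u` in the positive cone `C_i` of `u`: its projection on the
bisector of that cone is closest to `u`. -/
def IsClosestInCone (P : Finset Plane) (i : Fin 3) (u v : Plane) : Prop :=
  v ∈ P ∧ v ∈ positiveCone i u ∧
    ∀ w ∈ P, w ∈ positiveCone i u →
      inner ℝ (v - u) (bisector i) ≤ inner ℝ (w - u) (bisector i)

/-- The half-θ₆-graph on the point set `P`. (Points of the plane outside `P` are isolated.) -/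
def halfThetaSix (P : Finset Plane) : SimpleGraph Plane where
  Adj u v := u ∈ P ∧ v ∈ P ∧ ∃ i, IsClosestInCone P i u v ∨ IsClosestInCone P i v u
  symm := ⟨fun _ _ ⟨hu, hv, i, h⟩ => ⟨hv, hu, i, h.symm⟩⟩
  loopless := ⟨fun _ ⟨_, _, _, h⟩ => h.elim (fun h => h.2.1.1 rfl) (fun h => h.2.1.1 rfl)⟩

/-- The neighbours of `v` in the half-θ₆-graph that lie in its `i`-th negative cone. -/
def negNeighbors (P : Finset Plane) (i : Fin 3) (v : Plane) : Set Plane :=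
  {x | (halfThetaSix P).Adj v x ∧ x ∈ negativeCone i v}

/-- The planar cross product; for `a`, `b` in a common convex cone it is negative exactly if `b`
comes after `a` in clockwise order. -/
def cross (a b : Plane) : ℝ := a 0 * b 1 - a 1 * b 0

/-- `x` is the first neighbour of `v`, in clockwise order around `v`, in the `i`-th negative cone. -/
def IsFirstNeg (P : Finset Plane) (i : Fin 3) (v x : Plane) : Prop :=
  x ∈ negNeighbors P i v ∧ ∀ y ∈ negNeighbors P i v, cross (x - v) (y - v) ≤ 0

/-- `x` is the last neighbour of `v`, in clockwise order around `v`, in the `i`-th negative cone. -/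
def IsLastNeg (P : Finset Plane) (i : Fin 3) (v x : Plane) : Prop :=
  x ∈ negNeighbors P i v ∧ ∀ y ∈ negNeighbors P i v, 0 ≤ cross (x - v) (y - v)

/-- `x` is, among the neighbours of `v` in the `i`-th negative cone, the one whose projection on the
bisector of that cone is closest to `v`. -/
def IsClosestNeg (P : Finset Plane) (i : Fin 3) (v x : Plane) : Prop :=
  x ∈ negNeighbors P i v ∧ ∀ y ∈ negNeighbors P i v,
    inner ℝ (x - v) (- bisector i) ≤ inner ℝ (y - v) (- bisector i)

/-- The vertex `v` keeps its edge to `x`, a neighbour in one of its negative cones. -/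
def KeepsEdge (P : Finset Plane) (v x : Plane) : Prop :=
  ∃ i, IsFirstNeg P i v x ∨ IsLastNeg P i v x ∨ IsClosestNeg P i v x

/-- The subgraph `G₁₂` of the half-θ₆-graph: in each negative cone of each vertex all edges are
discarded except for the first and the last one in clockwise order and the one to the closest
neighbour. (Every edge lies in a negative cone of exactly one of its endpoints.) -/
def GTwelve (P : Finset Plane) : SimpleGraph Plane where
  Adj u v := (halfThetaSix P).Adj u v ∧ (KeepsEdge P u v ∨ KeepsEdge P v u)
  symm := ⟨fun _ _ h => ⟨h.1.symm, h.2.symm⟩⟩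
  loopless := ⟨fun _ h => h.1.ne rfl⟩

/-- The `k`-neighbourhood of `s`: the vertices reachable by following at most `k` edges. -/
def kNeighborhood (G : SimpleGraph Plane) (k : ℕ) (s : Plane) : Set Plane :=
  {v | ∃ p : G.Walk s v, p.length ≤ k}

/-- One unit of memory: an integer or a point. -/
inductive MemoryUnit : Type
  | int (k : ℕ)
  | point (p : Plane)

/-- The value of a memory unit is admissible for a graph with vertex set `P`, `n = #P`: an integer
has at most `log₂ n` bits (it is one of `0, …, n - 1`), and a point is the position of a vertex.
Arbitrary points are excluded, since one real number could encode the whole history of the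
message. -/
def MemoryUnit.Admissible (P : Finset Plane) : MemoryUnit → Prop
  | .int k => k < P.card
  | .point p => p ∈ P

/-- The memory of size `m` that is stored with the message. -/
abbrev Memory (m : ℕ) : Type := Fin m → MemoryUnit

/-- A deterministic `k`-local, `m`-memory routing algorithm: the next vertex and the next memory
contents are a function of the current vertex `s`, the destination `t`, the `k`-neighbourhood of
`s`, and the memory. -/
structure RoutingAlgorithm (k m : ℕ) where
  step : (s t : Plane) → (N : Set Plane) → Memory m → Plane × Memory m

/-- Position and memory of the message after a number of steps, when routing on `G` from `s` to `t`;
the memory initially contains zeros. -/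
def RoutingAlgorithm.run {k m : ℕ} (A : RoutingAlgorithm k m) (G : SimpleGraph Plane)
    (s t : Plane) : ℕ → Plane × Memory m
  | 0 => (s, fun _ => MemoryUnit.int 0)
  | j + 1 =>
    A.step (A.run G s t j).1 t (kNeighborhood G k (A.run G s t j).1) (A.run G s t j).2

/-- Routing on the graph `G` with vertex set `P` from `s`, the message follows edges of `G` and
arrives at `t` after finitely many steps and a total distance of at most `L`; up to then
all memory contents are admissible. -/
def RoutingAlgorithm.DeliversWithin {k m : ℕ} (A : RoutingAlgorithm k m) (P : Finset Plane)
    (G : SimpleGraph Plane) (s t : Plane) (L : ℝ) : Prop :=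
  ∃ N : ℕ, (A.run G s t N).1 = t ∧
    (∀ j < N, G.Adj (A.run G s t j).1 (A.run G s t (j + 1)).1) ∧
    (∀ j ≤ N, ∀ r, ((A.run G s t j).2 r).Admissible P) ∧
    ∑ j ∈ Finset.range N, dist (A.run G s t j).1 (A.run G s t (j + 1)).1 ≤ L

end

/-! Use three coordinates with sum zero in which the cone `C_i` of `u` consists of the points whose
two other coordinates exceed those of `u`; the half-θ₆-edge of `u` in `C_i` leads to the vertex with
the largest `i`-th coordinate there. The plan is to simulate a potential-driven routing on the
half-θ₆-graph and to pay a factor 19 for each of its edges.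

The neighbours of `v` in a negative cone form a chain, monotone in the two other coordinates.
Consecutive chain vertices are joined in `G₁₂`, and the step along the chain can be computed from a
neighbourhood alone (`ChainSucc.isNext`). If the edge from `s` to `v` was discarded, a two-sided
doubling search along the chain finds a vertex whose edge to `v` was kept. The neighbour `c` closest
to `v` is always kept; the search walks at most nine times the projected distance to `c`, and
`Nearest.detour` bounds this walk plus the last edge by `19 |sv|` (`SearchInv.cost_le`,
`search_result`). Conversely, a vertex reaches any of its negative neighbours by entering at `c` and
walking along the chain.

Toward `t` in a positive cone, the message follows the edge in that cone. With `t` in a negative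
cone it goes to a neighbour in the triangle between `t` and `s` if there is one, and otherwise to a
side region, the smaller one first. A failed search shows that the side is empty, emptiness persists
(`SideEmpty.of_descend`, `SideEmpty.of_side`), and a flag remembers it, so such a search fails at
most once. Each simulated edge lowers a potential by at least its length (`arrives_flag`,
`arrives_neg`, `arrives_pos`). The initial potentials are at most `2 |uw|` and `(5/√3) |uw|`;
multiplication by 19 gives the ratios. -/

noncomputable section

/-! ### Cone coordinates. -/

/-- The three cone coordinates of a point; they sum to zero, and the positive cone `C_i` at the
origin is the set where the two coordinates other than the `i`-th are nonnegative. -/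
def coneCoord (i : Fin 3) (p : Plane) : ℝ :=
  ![-(2 * p 1 / √3), p 0 + p 1 / √3, -p 0 + p 1 / √3] i

lemma coneCoord_sub (i : Fin 3) (p q : Plane) :
    coneCoord i (p - q) = coneCoord i p - coneCoord i q := by
  fin_cases i <;> simp [coneCoord] <;> ring

/-- Three pairwise distinct cone indices. -/
def Distinct3 (i j k : Fin 3) : Prop := i ≠ j ∧ i ≠ k ∧ j ≠ k

lemma Distinct3.swap {i j k : Fin 3} (h : Distinct3 i j k) : Distinct3 i k j :=
  ⟨h.2.1, h.1, h.2.2.symm⟩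

lemma Distinct3.rotate {i j k : Fin 3} (h : Distinct3 i j k) : Distinct3 j k i :=
  ⟨h.2.2, h.1.symm, h.2.1.symm⟩

lemma Distinct3.sum_eq_zero {i j k : Fin 3} (h : Distinct3 i j k) (p : Plane) :
    coneCoord i p + coneCoord j p + coneCoord k p = 0 := by
  revert h
  fin_cases i <;> fin_cases j <;> fin_cases k <;> simp [Distinct3, coneCoord] <;> ring

lemma Distinct3.forall_ne {i j k : Fin 3} (h : Distinct3 i j k) {Q : Fin 3 → Prop} :
    (∀ l, l ≠ i → Q l) ↔ Q j ∧ Q k := by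
  refine ⟨fun H => ⟨H j h.1.symm, H k h.2.1.symm⟩, fun H l hl => ?_⟩
  have : l = j ∨ l = k := by
    clear H; revert h hl; revert i j k l; unfold Distinct3; decide
  rcases this with rfl | rfl
  exacts [H.1, H.2]

lemma Distinct3.exists_of (i : Fin 3) : ∃ j k, Distinct3 i j k := by
  revert i; unfold Distinct3; decide

lemma dist_sq_eq {i j k : Fin 3} (h : Distinct3 i j k) (p q : Plane) :
    dist p q ^ 2 = (coneCoord j q - coneCoord j p) ^ 2 + (coneCoord k q - coneCoord k p) ^ 2
      + (coneCoord j q - coneCoord j p) * (coneCoord k q - coneCoord k p) := by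
  have h3 : (√3 : ℝ) ^ 2 = 3 := by norm_num
  have h0 : (√3 : ℝ) ≠ 0 := by positivity
  rw [EuclideanSpace.dist_eq, Real.sq_sqrt (by positivity)]
  simp only [Fin.sum_univ_two, Real.dist_eq, sq_abs]
  revert h
  fin_cases i <;> fin_cases j <;> fin_cases k <;> simp [Distinct3, coneCoord] <;>
    · field_simp
      ring_nf
      try simp only [h3]
      try ring

lemma dist_le_add {i j k : Fin 3} (h : Distinct3 i j k) (p q : Plane) :
    dist p q ≤ |coneCoord j q - coneCoord j p| + |coneCoord k q - coneCoord k p| := by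
  refine abs_le_of_sq_le_sq' ?_ (by positivity) |>.2
  rw [dist_sq_eq h, add_sq, sq_abs, sq_abs]
  have : (coneCoord j q - coneCoord j p) * (coneCoord k q - coneCoord k p)
    ≤ |coneCoord j q - coneCoord j p| * |coneCoord k q - coneCoord k p| := by
    rw [← abs_mul]; exact le_abs_self _
  nlinarith [abs_nonneg (coneCoord j q - coneCoord j p), abs_nonneg (coneCoord k q - coneCoord k p),
    mul_nonneg (abs_nonneg (coneCoord j q - coneCoord j p))
      (abs_nonneg (coneCoord k q - coneCoord k p))]

lemma unitDir_add_pi (θ : ℝ) : unitDir (θ + Real.pi) = - unitDir θ := by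
  ext l; fin_cases l <;> simp [unitDir]

lemma mem_coneAt_add_three {k : ℕ} {u v : Plane} : v ∈ coneAt (k + 3) u ↔ u ∈ coneAt k v := by
  have e : ∀ x : ℝ, unitDir ((x + 3) * Real.pi / 3) = - unitDir (x * Real.pi / 3) := by
    intro x; rw [← unitDir_add_pi]; congr 1; ring
  have e1 := e k
  have e2 := e (k + 1)
  rw [show (k : ℝ) + 1 + 3 = k + 3 + 1 by ring] at e2
  simp only [coneAt, Set.mem_ofPred_eq, Nat.cast_add, Nat.cast_ofNat, e1, e2]
  refine and_congr ne_comm (exists_congr fun a => exists_congr fun b => ?_)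
  refine and_congr_right fun _ => and_congr_right fun _ => ?_
  constructor <;> intro h
  · rw [← neg_sub, h]; module
  · rw [← neg_sub, h]; module

lemma mem_negativeCone {i : Fin 3} {u v : Plane} :
    v ∈ negativeCone i u ↔ u ∈ positiveCone i v :=
  mem_coneAt_add_three (k := 2 * i.val + 1)

lemma unitDir_one : unitDir (Real.pi / 3) = !₂[1 / 2, √3 / 2] := by
  rw [unitDir, Real.cos_pi_div_three, Real.sin_pi_div_three]

lemma unitDir_zero : unitDir (0 * Real.pi / 3) = !₂[1, 0] := by
  simp [unitDir]

lemma unitDir_two : unitDir (2 * Real.pi / 3) = !₂[-(1 / 2), √3 / 2] := by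
  rw [show 2 * Real.pi / 3 = Real.pi - Real.pi / 3 by ring, unitDir, Real.cos_pi_sub,
    Real.sin_pi_sub, Real.cos_pi_div_three, Real.sin_pi_div_three]

lemma unitDir_three : unitDir Real.pi = !₂[-1, 0] := by
  simp [unitDir]

lemma unitDir_four : unitDir (4 * Real.pi / 3) = !₂[-(1 / 2), -(√3 / 2)] := by
  rw [show 4 * Real.pi / 3 = Real.pi / 3 + Real.pi by ring, unitDir_add_pi, unitDir_one]
  ext l; fin_cases l <;> simp

lemma unitDir_five : unitDir (5 * Real.pi / 3) = !₂[1 / 2, -(√3 / 2)] := by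
  rw [show 5 * Real.pi / 3 = 2 * Real.pi / 3 + Real.pi by ring, unitDir_add_pi, unitDir_two]
  ext l; fin_cases l <;> simp

lemma unitDir_six : unitDir (6 * Real.pi / 3) = !₂[1, 0] := by
  rw [show 6 * Real.pi / 3 = Real.pi + Real.pi by ring, unitDir_add_pi, unitDir_three]
  ext l; fin_cases l <;> simp

lemma plane_eq_iff {p q : Plane} : p = q ↔ p 0 = q 0 ∧ p 1 = q 1 := by
  constructor
  · rintro rfl; exact ⟨rfl, rfl⟩
  · rintro ⟨h0, h1⟩; ext l; fin_cases l <;> assumption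

lemma mem_positiveCone {i : Fin 3} {u v : Plane} :
    v ∈ positiveCone i u ↔ v ≠ u ∧ ∀ j, j ≠ i → coneCoord j u ≤ coneCoord j v := by
  have h3 : (√3 : ℝ) * √3 = 3 := by norm_num
  have hp : (0 : ℝ) < √3 := by positivity
  have h0 : (√3 : ℝ) ≠ 0 := hp.ne'
  refine and_congr_right fun _ => ?_
  have key : ∀ j, coneCoord j u ≤ coneCoord j v ↔ 0 ≤ coneCoord j (v - u) := fun j => by
    rw [coneCoord_sub, sub_nonneg]
  simp only [key]
  generalize v - u = w
  constructor
  · rintro ⟨a, b, ha, hb, h⟩ j hj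
    subst h
    revert hj
    fin_cases i
    all_goals
      norm_num [unitDir_one, unitDir_two, unitDir_three, unitDir_four, unitDir_five, unitDir_six]
      fin_cases j <;> simp [coneCoord] <;> field_simp <;> nlinarith
  · intro h
    fin_cases i
    -- The two other cone coordinates are the coefficients of `w` with respect to the boundary rays
    -- of the cone.
    · refine ⟨coneCoord 1 w, coneCoord 2 w, h 1 (by simp), h 2 (by simp), ?_⟩
      norm_num [unitDir_one, unitDir_two]
      rw [plane_eq_iff]; simp [coneCoord]; constructor <;> (field_simp; ring)
    · refine ⟨coneCoord 2 w, coneCoord 0 w, h 2 (by simp), h 0 (by simp), ?_⟩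
      norm_num [unitDir_three, unitDir_four]
      rw [plane_eq_iff]; simp [coneCoord]; constructor <;> field_simp
      ring
    · refine ⟨coneCoord 0 w, coneCoord 1 w, h 0 (by simp), h 1 (by simp), ?_⟩
      norm_num [unitDir_five, unitDir_six]
      rw [plane_eq_iff]; simp [coneCoord]; constructor <;> field_simp
      ring

lemma inner_bisector (i : Fin 3) (p : Plane) :
    inner ℝ p (bisector i) = - (√3 / 2) * coneCoord i p := by
  have h3 : (√3 : ℝ) ^ 2 = 3 := by norm_num
  have h0 : (√3 : ℝ) ≠ 0 := by positivity
  -- The bisector is the first boundary ray turned by `π/6`; the quantified `x` plays no role.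
  have e : ∀ x : ℝ, bisector i = !₂[-(unitDir ((2 * i.val + 1) * Real.pi / 3) 1) * (1/2)
      + unitDir ((2 * i.val + 1) * Real.pi / 3) 0 * (√3/2),
      unitDir ((2 * i.val + 1) * Real.pi / 3) 1 * (√3/2)
      + unitDir ((2 * i.val + 1) * Real.pi / 3) 0 * (1/2)] := by
    intro x
    rw [bisector, unitDir, Real.cos_add, Real.sin_add, Real.cos_pi_div_six, Real.sin_pi_div_six]
    rw [plane_eq_iff]; simp [unitDir]; ring
  rw [e 0]
  simp only [PiLp.inner_apply, Fin.sum_univ_two]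
  fin_cases i <;>
    norm_num [unitDir_one, unitDir_three, unitDir_five, coneCoord] <;> field_simp <;>
      ring_nf <;> (try simp only [h3]) <;> (try ring)

lemma GeneralPosition.coneCoord_ne {P : Finset Plane} (h : GeneralPosition P) {u v : Plane}
    (hu : u ∈ P) (hv : v ∈ P) (hne : u ≠ v) (i : Fin 3) : coneCoord i u ≠ coneCoord i v := by
  have h0 : (√3 : ℝ) ≠ 0 := by positivity
  intro e
  have H := h u hu v hv hne
  have e' : coneCoord i (v - u) = 0 := by rw [coneCoord_sub, e, sub_self]
  generalize v - u = w at H e'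
  fin_cases i <;> simp [coneCoord] at e'
  · apply H 0 (w 0)
    rw [Nat.cast_zero, unitDir_zero, plane_eq_iff]; simp [e']
  · apply H 2 (2 * w 1 / √3)
    rw [Nat.cast_ofNat, unitDir_two, plane_eq_iff]; simp
    constructor
    · linear_combination e'
    · field_simp
  · apply H 1 (2 * w 1 / √3)
    rw [Nat.cast_one, one_mul, unitDir_one, plane_eq_iff]; simp
    constructor
    · linear_combination -e'
    · field_simp

lemma cross_eq (a b : Plane) :
    cross a b = √3 / 2 * (coneCoord 1 a * coneCoord 2 b - coneCoord 2 a * coneCoord 1 b) := by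
  have h0 : (√3 : ℝ) ≠ 0 := by positivity
  simp [cross, coneCoord]; field_simp; ring

end

/-! ### The half-θ₆-graph and `G₁₂` in cone coordinates. -/

noncomputable section

/-- `v` lies in the open positive cone `C_i` of `u`. -/
def InCone (i : Fin 3) (u v : Plane) : Prop := ∀ j, j ≠ i → coneCoord j u < coneCoord j v

/-- `v` is the vertex that `u` is joined to in its positive cone `C_i`. -/
def Nearest (P : Finset Plane) (i : Fin 3) (u v : Plane) : Prop :=
  v ∈ P ∧ InCone i u v ∧ ∀ w ∈ P, InCone i u w → coneCoord i w ≤ coneCoord i v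

/-- The edge from `x` to its nearest vertex `v` in the cone `C_i` belongs to `G₁₂`. -/
def Kept (P : Finset Plane) (i : Fin 3) (x v : Plane) : Prop :=
  x ∈ P ∧ Nearest P i x v ∧
    ((∃ j, j ≠ i ∧ ∀ y ∈ P, Nearest P i y v → coneCoord j y ≤ coneCoord j x) ∨
      ∀ y ∈ P, Nearest P i y v → coneCoord i x ≤ coneCoord i y)

lemma Distinct3.inCone {i j k : Fin 3} (h : Distinct3 i j k) {u v : Plane} :
    InCone i u v ↔ coneCoord j u < coneCoord j v ∧ coneCoord k u < coneCoord k v :=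
  h.forall_ne

lemma InCone.lt {i : Fin 3} {u v : Plane} (h : InCone i u v) : coneCoord i v < coneCoord i u := by
  obtain ⟨j, k, hd⟩ := Distinct3.exists_of i
  have := hd.inCone.1 h
  have := hd.sum_eq_zero u
  have := hd.sum_eq_zero v
  linarith

lemma InCone.ne {i : Fin 3} {u v : Plane} (h : InCone i u v) : u ≠ v := by
  rintro rfl; exact lt_irrefl _ h.lt

variable {P : Finset Plane}

lemma GeneralPosition.mem_positiveCone_iff (hP : GeneralPosition P) {i : Fin 3} {u v : Plane}
    (hu : u ∈ P) (hv : v ∈ P) : v ∈ positiveCone i u ↔ InCone i u v := by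
  rw [mem_positiveCone]
  constructor
  · rintro ⟨hne, h⟩ j hj
    exact lt_of_le_of_ne (h j hj) (hP.coneCoord_ne hu hv hne.symm j)
  · exact fun h => ⟨h.ne.symm, fun j hj => (h j hj).le⟩

lemma GeneralPosition.isClosestInCone_iff (hP : GeneralPosition P) {i : Fin 3} {u v : Plane}
    (hu : u ∈ P) : IsClosestInCone P i u v ↔ Nearest P i u v := by
  have h3 : (0 : ℝ) < √3 := by positivity
  refine and_congr_right fun hv => and_congr (hP.mem_positiveCone_iff hu hv) ?_
  refine forall_congr' fun w => forall_congr' fun hw => ?_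
  rw [hP.mem_positiveCone_iff hu hw]
  refine forall_congr' fun _ => ?_
  rw [inner_bisector, inner_bisector, coneCoord_sub, coneCoord_sub]
  constructor <;> intro <;> nlinarith

lemma GeneralPosition.inCone_cases (hP : GeneralPosition P) {u v : Plane} (hu : u ∈ P) (hv : v ∈ P)
    (hne : u ≠ v) : ∃ i, InCone i u v ∨ InCone i v u := by
  have d0 : Distinct3 0 1 2 := by unfold Distinct3; decide
  have := hP.coneCoord_ne hu hv hne
  have s1 := d0.sum_eq_zero u
  have s2 := d0.sum_eq_zero v
  rcases lt_or_gt_of_ne (this 0) with h0 | h0 <;> rcases lt_or_gt_of_ne (this 1) with h1 | h1 <;>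
    rcases lt_or_gt_of_ne (this 2) with h2 | h2
  · linarith
  · exact ⟨2, .inl (d0.rotate.rotate.inCone.2 ⟨h0, h1⟩)⟩
  · exact ⟨1, .inl (d0.rotate.inCone.2 ⟨h2, h0⟩)⟩
  · exact ⟨0, .inr (d0.inCone.2 ⟨h1, h2⟩)⟩
  · exact ⟨0, .inl (d0.inCone.2 ⟨h1, h2⟩)⟩
  · exact ⟨1, .inr (d0.rotate.inCone.2 ⟨h2, h0⟩)⟩
  · exact ⟨2, .inr (d0.rotate.rotate.inCone.2 ⟨h0, h1⟩)⟩
  · linarith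

lemma InCone.index_unique {i i' : Fin 3} {u v : Plane} (h : InCone i u v) (h' : InCone i' u v) :
    i = i' := by
  by_contra hne
  exact lt_asymm h.lt (h' i hne)

lemma InCone.not_inCone_swap {i i' : Fin 3} {u v : Plane} (h : InCone i u v) : ¬ InCone i' v u := by
  intro h'
  obtain ⟨j, k, hd⟩ := Distinct3.exists_of i
  obtain ⟨h1, h2⟩ := hd.inCone.1 h
  by_cases hj : j = i'
  · exact lt_asymm h2 (h' k (hj ▸ hd.2.2.symm))
  · exact lt_asymm h1 (h' j hj)

lemma Nearest.unique (hP : GeneralPosition P) {i : Fin 3} {u v w : Plane} (h : Nearest P i u v)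
    (h' : Nearest P i u w) : v = w := by
  by_contra hne
  exact hP.coneCoord_ne h.1 h'.1 hne i (le_antisymm (h'.2.2 v h.1 h.2.1) (h.2.2 w h'.1 h'.2.1))

lemma Nearest.not_inCone {i : Fin 3} {x y v : Plane} (hx : Nearest P i x v) (hy : Nearest P i y v)
    (hyP : y ∈ P) : ¬ InCone i x y := fun h =>
  (hy.2.1.lt).not_ge (hx.2.2 y hyP h)

lemma exists_nearest {i : Fin 3} {u v : Plane} (hv : v ∈ P) (h : InCone i u v) :
    ∃ w, Nearest P i u w := by
  classical
  obtain ⟨w, hw, hmax⟩ := (P.filter fun w => InCone i u w).exists_max_image (coneCoord i)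
    ⟨v, Finset.mem_filter.2 ⟨hv, h⟩⟩
  rw [Finset.mem_filter] at hw
  exact ⟨w, hw.1, hw.2, fun z hz hz' => hmax z (Finset.mem_filter.2 ⟨hz, hz'⟩)⟩

lemma GeneralPosition.halfThetaSix_adj_iff (hP : GeneralPosition P) {u v : Plane} :
    (halfThetaSix P).Adj u v ↔
      u ∈ P ∧ v ∈ P ∧ ∃ i, Nearest P i u v ∨ Nearest P i v u := by
  refine and_congr_right fun hu => and_congr_right fun hv => exists_congr fun i => ?_
  rw [hP.isClosestInCone_iff hu, hP.isClosestInCone_iff hv]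

lemma GeneralPosition.mem_negNeighbors_iff (hP : GeneralPosition P) {i : Fin 3} {v x : Plane} :
    x ∈ negNeighbors P i v ↔ x ∈ P ∧ Nearest P i x v := by
  rw [negNeighbors, Set.mem_ofPred_eq, hP.halfThetaSix_adj_iff, mem_negativeCone]
  constructor
  · rintro ⟨⟨hv, hx, l, h | h⟩, hc⟩ <;> rw [hP.mem_positiveCone_iff hx hv] at hc
    · exact absurd h.2.1 hc.not_inCone_swap
    · exact ⟨hx, hc.index_unique h.2.1 ▸ h⟩
  · rintro ⟨hx, h⟩
    exact ⟨⟨h.1, hx, i, .inr h⟩, (hP.mem_positiveCone_iff hx h.1).2 h.2.1⟩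

lemma cross_eq_cyclic (i : Fin 3) (a b : Plane) :
    cross a b = √3 / 2 * (coneCoord (i + 1) a * coneCoord (i + 2) b
      - coneCoord (i + 2) a * coneCoord (i + 1) b) := by
  have d0 : Distinct3 0 1 2 := by unfold Distinct3; decide
  have s1 := d0.sum_eq_zero a
  have s2 := d0.sum_eq_zero b
  have e1 : coneCoord 0 a = - coneCoord 1 a - coneCoord 2 a := by linarith
  have e2 : coneCoord 0 b = - coneCoord 1 b - coneCoord 2 b := by linarith
  rw [cross_eq]
  fin_cases i <;> simp [e1, e2]
  all_goals ring

lemma distinct3_cyclic (i : Fin 3) : Distinct3 i (i + 1) (i + 2) := by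
  revert i; unfold Distinct3; decide

/-- Neither of two negative neighbours lies in the cone `C_i` of the other, so their two other
coordinates are ordered oppositely. This fixes the sign of the cross product, and the clockwise
order becomes the order of one coordinate. -/
lemma cross_nonpos_iff (hP : GeneralPosition P) {i : Fin 3} {v x y : Plane} (hx : x ∈ P)
    (hy : y ∈ P) (h : Nearest P i x v) (h' : Nearest P i y v) :
    (cross (x - v) (y - v) ≤ 0 ↔ coneCoord (i + 1) y ≤ coneCoord (i + 1) x) ∧
      (0 ≤ cross (x - v) (y - v) ↔ coneCoord (i + 2) y ≤ coneCoord (i + 2) x) := by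
  have h3 : (0 : ℝ) < √3 / 2 := by positivity
  rcases eq_or_ne x y with rfl | hne
  · simp [cross, mul_comm]
  have hd := distinct3_cyclic i
  have c1 := hd.inCone.1 h.2.1
  have c2 := hd.inCone.1 h'.2.1
  have n1 := mt hd.inCone.2 (h.not_inCone h' hy)
  have n2 := mt hd.inCone.2 (h'.not_inCone h hx)
  rw [cross_eq_cyclic i]
  simp only [coneCoord_sub]
  rcases lt_or_gt_of_ne (hP.coneCoord_ne hx hy hne (i + 1)) with hj | hj <;>
    rcases lt_or_gt_of_ne (hP.coneCoord_ne hx hy hne (i + 2)) with hk | hk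
  · exact absurd ⟨hj, hk⟩ n1
  · have : 0 < √3 / 2 * ((coneCoord (i + 1) x - coneCoord (i + 1) v) *
        (coneCoord (i + 2) y - coneCoord (i + 2) v) -
        (coneCoord (i + 2) x - coneCoord (i + 2) v) *
        (coneCoord (i + 1) y - coneCoord (i + 1) v)) := mul_pos h3 (by nlinarith)
    exact ⟨iff_of_false this.not_ge hj.not_ge, iff_of_true this.le hk.le⟩
  · have : √3 / 2 * ((coneCoord (i + 1) x - coneCoord (i + 1) v) *
        (coneCoord (i + 2) y - coneCoord (i + 2) v) -
        (coneCoord (i + 2) x - coneCoord (i + 2) v) *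
        (coneCoord (i + 1) y - coneCoord (i + 1) v)) < 0 :=
      mul_neg_of_pos_of_neg h3 (by nlinarith)
    exact ⟨iff_of_true this.le hj.le, iff_of_false this.not_ge hk.not_ge⟩
  · exact absurd ⟨hj, hk⟩ n2

/-- The first and the last neighbour become the maximizers of the coordinates `i + 1` and `i + 2`,
and the closest one the minimizer of coordinate `i`. The result is symmetric in the two sides. -/
lemma GeneralPosition.keepsEdge_iff (hP : GeneralPosition P) {v x : Plane} :
    KeepsEdge P v x ↔ ∃ i, Kept P i x v := by
  have h3 : (0 : ℝ) < √3 / 2 := by positivity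
  refine exists_congr fun i => ?_
  have hd := distinct3_cyclic i
  by_cases hx : x ∈ P ∧ Nearest P i x v
  swap
  · simp only [IsFirstNeg, IsLastNeg, IsClosestNeg, Kept, hP.mem_negNeighbors_iff, hx, false_and,
      or_self, ← and_assoc]
  have e1 : IsFirstNeg P i v x ↔
      ∀ y ∈ P, Nearest P i y v → coneCoord (i + 1) y ≤ coneCoord (i + 1) x := by
    simp only [IsFirstNeg, hP.mem_negNeighbors_iff, hx, true_and, and_imp, and_self]
    exact forall_congr' fun y => forall_congr' fun hy => forall_congr' fun h =>
      (cross_nonpos_iff hP hx.1 hy hx.2 h).1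
  have e2 : IsLastNeg P i v x ↔
      ∀ y ∈ P, Nearest P i y v → coneCoord (i + 2) y ≤ coneCoord (i + 2) x := by
    simp only [IsLastNeg, hP.mem_negNeighbors_iff, hx, true_and, and_imp, and_self]
    exact forall_congr' fun y => forall_congr' fun hy => forall_congr' fun h =>
      (cross_nonpos_iff hP hx.1 hy hx.2 h).2
  have e3 : IsClosestNeg P i v x ↔
      ∀ y ∈ P, Nearest P i y v → coneCoord i x ≤ coneCoord i y := by
    simp only [IsClosestNeg, hP.mem_negNeighbors_iff, hx, true_and, and_imp, and_self,
      inner_neg_right, inner_bisector, coneCoord_sub]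
    exact forall_congr' fun y => forall_congr' fun hy => forall_congr' fun h =>
      ⟨fun _ => by nlinarith, fun _ => by nlinarith⟩
  have e4 : (∃ j, j ≠ i ∧ ∀ y ∈ P, Nearest P i y v → coneCoord j y ≤ coneCoord j x) ↔
      IsFirstNeg P i v x ∨ IsLastNeg P i v x := by
    rw [e1, e2]
    constructor
    · rintro ⟨j, hj, H⟩
      by_contra hc
      rw [not_or] at hc
      exact (hd.forall_ne (Q := fun j => ¬ ∀ y ∈ P, Nearest P i y v →
        coneCoord j y ≤ coneCoord j x)).2 hc j hj H
    · rintro (H | H)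
      exacts [⟨_, hd.1.symm, H⟩, ⟨_, hd.2.1.symm, H⟩]
  rw [Kept, e4, ← e3, or_assoc]
  exact ⟨fun h => ⟨hx.1, hx.2, h⟩, fun h => h.2.2⟩

lemma GeneralPosition.gTwelve_adj_iff (hP : GeneralPosition P) {u v : Plane} :
    (GTwelve P).Adj u v ↔ ∃ i, Kept P i u v ∨ Kept P i v u := by
  have e : (GTwelve P).Adj u v ↔ (halfThetaSix P).Adj u v ∧ (KeepsEdge P u v ∨ KeepsEdge P v u) :=
    Iff.rfl
  rw [e, hP.halfThetaSix_adj_iff, hP.keepsEdge_iff, hP.keepsEdge_iff, ← exists_or]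
  constructor
  · rintro ⟨-, i, h⟩
    exact ⟨i, h.symm⟩
  · rintro ⟨i, h | h⟩
    · exact ⟨⟨h.1, h.2.1.1, i, .inl h.2.1⟩, i, .inr h⟩
    · exact ⟨⟨h.2.1.1, h.1, i, .inr h.2.1⟩, i, .inl h⟩

lemma mem_kNeighborhood_one {G : SimpleGraph Plane} {u v : Plane} :
    v ∈ kNeighborhood G 1 u ↔ v = u ∨ G.Adj u v := by
  constructor
  · rintro ⟨p, hp⟩
    cases p with
    | nil => exact .inl rfl
    | cons h q =>
      cases q with
      | nil => exact .inr h
      | cons h' q' => simp at hp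
  · rintro (rfl | h)
    · exact ⟨.nil, by simp⟩
    · exact ⟨h.toWalk, by simp⟩

/-- `y` is visible in `G₁₂` from `x` in the positive cone `C_i` of `x`. -/
lemma GeneralPosition.adj_and_inCone_iff (hP : GeneralPosition P) {i : Fin 3} {x y : Plane} :
    (GTwelve P).Adj x y ∧ InCone i x y ↔ Kept P i x y := by
  rw [hP.gTwelve_adj_iff]
  constructor
  · rintro ⟨⟨l, h | h⟩, hc⟩
    · exact h.2.1.2.1.index_unique hc ▸ h
    · exact absurd h.2.1.2.1 hc.not_inCone_swap
  · exact fun h => ⟨⟨i, .inl h⟩, h.2.1.2.1⟩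

end

/-! ### Chains of negative neighbours and the local rule for following them. -/

noncomputable section

variable {P : Finset Plane}

/-- `x` is a vertex whose cone `C_i` contains `v` and no vertex closer than `v`. The anchor `v`
need not be a vertex. -/
def OnChain (P : Finset Plane) (i : Fin 3) (v x : Plane) : Prop :=
  x ∈ P ∧ InCone i x v ∧ ∀ w ∈ P, InCone i x w → coneCoord i w ≤ coneCoord i v

/-- `x'` follows `x` on the chain of `v` in the direction in which the `j`-th coordinate grows. -/
def ChainSucc (P : Finset Plane) (i j : Fin 3) (v x x' : Plane) : Prop :=
  OnChain P i v x ∧ OnChain P i v x' ∧ coneCoord j x < coneCoord j x' ∧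
    ∀ z, OnChain P i v z → coneCoord j x < coneCoord j z → coneCoord j x' ≤ coneCoord j z

/-- The local rule for the next vertex after `x` on a chain in direction `j`, where `k` is the
opposite direction and `N` is the neighbourhood of `x`. -/
def IsNext (N : Set Plane) (j k : Fin 3) (x y : Plane) : Prop :=
  (y ∈ N ∧ InCone j y x ∧ ∀ z ∈ N, InCone j z x → coneCoord k z ≤ coneCoord k y) ∨
    ((∀ z ∈ N, ¬ InCone j z x) ∧ y ∈ N ∧ InCone k x y)

/-- The neighbourhood of `x` in `G₁₂`. -/
abbrev nbhd (P : Finset Plane) (x : Plane) : Set Plane := kNeighborhood (GTwelve P) 1 x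

lemma onChain_iff_nearest {i : Fin 3} {v x : Plane} (hv : v ∈ P) :
    OnChain P i v x ↔ x ∈ P ∧ Nearest P i x v := by
  simp [OnChain, Nearest, hv]

lemma GeneralPosition.mem_nbhd_inCone (hP : GeneralPosition P) {i : Fin 3} {x y : Plane} :
    (y ∈ nbhd P x ∧ InCone i x y) ↔ Kept P i x y := by
  rw [mem_kNeighborhood_one, ← hP.adj_and_inCone_iff]
  refine and_congr_left fun h => ?_
  simp [h.ne.symm]

lemma GeneralPosition.mem_nbhd_inCone_swap (hP : GeneralPosition P) {i : Fin 3} {x y : Plane} :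
    (y ∈ nbhd P x ∧ InCone i y x) ↔ Kept P i y x := by
  rw [mem_kNeighborhood_one, ← hP.adj_and_inCone_iff, SimpleGraph.adj_comm]
  refine and_congr_left fun h => ?_
  simp [h.ne]

lemma IsNext.unique (hP : GeneralPosition P) {j k : Fin 3} {x y z : Plane} (hy : IsNext (nbhd P x) j k x y) (hz : IsNext (nbhd P x) j k x z) :
    y = z := by
  rcases hy with ⟨h1, h2, h3⟩ | ⟨h1, h2, h3⟩ <;> rcases hz with ⟨g1, g2, g3⟩ | ⟨g1, g2, g3⟩
  · have a := hP.mem_nbhd_inCone_swap.1 ⟨h1, h2⟩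
    have b := hP.mem_nbhd_inCone_swap.1 ⟨g1, g2⟩
    by_contra hne
    exact hP.coneCoord_ne a.1 b.1 hne k (le_antisymm (g3 _ h1 h2) (h3 _ g1 g2))
  · exact absurd h2 (g1 _ h1)
  · exact absurd g2 (h1 _ g1)
  · exact (hP.mem_nbhd_inCone.1 ⟨h2, h3⟩).2.1.unique hP (hP.mem_nbhd_inCone.1 ⟨g2, g3⟩).2.1

lemma IsNext.adj (hP : GeneralPosition P) {j k : Fin 3}
    {x y : Plane} (h : IsNext (nbhd P x) j k x y) : (GTwelve P).Adj x y := by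
  rw [hP.gTwelve_adj_iff]
  rcases h with ⟨h1, h2, -⟩ | ⟨-, h1, h2⟩
  exacts [⟨_, .inr (hP.mem_nbhd_inCone_swap.1 ⟨h1, h2⟩)⟩, ⟨_, .inl (hP.mem_nbhd_inCone.1 ⟨h1, h2⟩)⟩]

lemma OnChain.not_inCone {i : Fin 3} {v x y : Plane} (hx : OnChain P i v x)
    (hy : OnChain P i v y) : ¬ InCone i x y := fun h =>
  (hy.2.1.lt).not_ge (hx.2.2 y hy.1 h)

lemma OnChain.lt_iff (hP : GeneralPosition P) {i j k : Fin 3} (hd : Distinct3 i j k) {v x y : Plane}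
    (hx : OnChain P i v x) (hy : OnChain P i v y) :
    coneCoord j x < coneCoord j y ↔ coneCoord k y < coneCoord k x := by
  rcases eq_or_ne x y with rfl | hne
  · simp
  have n1 := mt hd.inCone.2 (hx.not_inCone hy)
  have n2 := mt hd.inCone.2 (hy.not_inCone hx)
  rcases lt_or_gt_of_ne (hP.coneCoord_ne hx.1 hy.1 hne j) with hj | hj <;>
    rcases lt_or_gt_of_ne (hP.coneCoord_ne hx.1 hy.1 hne k) with hk | hk
  · exact absurd ⟨hj, hk⟩ n1
  · exact iff_of_true hj hk
  · exact iff_of_false hj.not_gt hk.not_gt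
  · exact absurd ⟨hj, hk⟩ n2

lemma OnChain.le_iff (hP : GeneralPosition P) {i j k : Fin 3} (hd : Distinct3 i j k) {v x y : Plane}
    (hx : OnChain P i v x) (hy : OnChain P i v y) :
    coneCoord j x ≤ coneCoord j y ↔ coneCoord k y ≤ coneCoord k x := by
  rw [← not_lt, ← not_lt, hy.lt_iff hP hd hx]

lemma ChainSucc.swap (hP : GeneralPosition P) {i j k : Fin 3} (hd : Distinct3 i j k) {v x x' : Plane}
    (h : ChainSucc P i j v x x') : ChainSucc P i k v x' x := by
  refine ⟨h.2.1, h.1, (h.1.lt_iff hP hd h.2.1).1 h.2.2.1, fun z hz hlt => ?_⟩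
  by_contra hc
  rw [not_le, ← h.1.lt_iff hP hd hz] at hc
  rw [← hz.lt_iff hP hd h.2.1] at hlt
  exact (h.2.2.2 z hz hc).not_gt hlt

lemma OnChain.exists_succ {i j : Fin 3} {v x y : Plane} (hx : OnChain P i v x)
    (hy : OnChain P i v y) (h : coneCoord j x < coneCoord j y) : ∃ x', ChainSucc P i j v x x' := by
  classical
  obtain ⟨z, hz, hmin⟩ := (P.filter fun z => OnChain P i v z ∧ coneCoord j x < coneCoord j z)
    |>.exists_min_image (coneCoord j) ⟨y, Finset.mem_filter.2 ⟨hy.1, hy, h⟩⟩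
  rw [Finset.mem_filter] at hz
  exact ⟨z, hx, hz.2.1, hz.2.2, fun w hw hlt => hmin w (Finset.mem_filter.2 ⟨hw.1, hw, hlt⟩)⟩

/-- A minimality principle: a nonempty region that is closed under passing to cones above the
level of `v` contains a chain vertex. -/
lemma exists_onChain_of_region {i : Fin 3} {v z : Plane} {R : Plane → Prop} (hz : z ∈ P) (hR : R z)
    (hv : ∀ p ∈ P, R p → InCone i p v)
    (hcl : ∀ p ∈ P, R p → ∀ w ∈ P, InCone i p w → coneCoord i v < coneCoord i w → R w) :
    ∃ p, R p ∧ OnChain P i v p := by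
  classical
  obtain ⟨p, hp, hmin⟩ := (P.filter R).exists_min_image (coneCoord i)
    ⟨z, Finset.mem_filter.2 ⟨hz, hR⟩⟩
  rw [Finset.mem_filter] at hp
  refine ⟨p, hp.2, hp.1, hv p hp.1 hp.2, fun w hw hpw => ?_⟩
  by_contra hc
  exact (hmin w (Finset.mem_filter.2 ⟨hw, hcl p hp.1 hp.2 w hw hpw (not_le.1 hc)⟩)).not_gt hpw.lt

/-- Such a `z` above the level of `v` would lie in a region between `x` and `x'` that is closed
under passing to higher cones above that level. The region would then contain a chain vertex
strictly between the two consecutive ones. -/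
lemma ChainSucc.gap_empty (hP : GeneralPosition P) {i j k : Fin 3} (hd : Distinct3 i j k)
    {v x x' z : Plane} (h : ChainSucc P i j v x x') (hz : z ∈ P)
    (h1 : coneCoord j x < coneCoord j z) (h2 : coneCoord k x' < coneCoord k z) :
    coneCoord i z ≤ coneCoord i v := by
  by_contra h3
  rw [not_le] at h3
  have key : ∀ p ∈ P, coneCoord j x < coneCoord j p → coneCoord k x' < coneCoord k p →
      coneCoord i v < coneCoord i p →
      coneCoord k p ≤ coneCoord k x ∧ coneCoord j p ≤ coneCoord j x' := by
    intro p hp a b c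
    constructor
    · by_contra hc
      exact (h.1.2.2 p hp (hd.inCone.2 ⟨a, not_le.1 hc⟩)).not_gt c
    · by_contra hc
      exact (h.2.1.2.2 p hp (hd.inCone.2 ⟨not_le.1 hc, b⟩)).not_gt c
  have cx := hd.inCone.1 h.1.2.1
  have cx' := hd.inCone.1 h.2.1.2.1
  obtain ⟨p, hp, hpc⟩ := exists_onChain_of_region (i := i) (v := v) (R := fun p =>
      coneCoord j x < coneCoord j p ∧ coneCoord k x' < coneCoord k p ∧
      coneCoord i v < coneCoord i p) hz ⟨h1, h2, h3⟩
    (fun p hp hR => by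
      have := key p hp hR.1 hR.2.1 hR.2.2
      exact hd.inCone.2 ⟨by linarith, by linarith⟩)
    (fun p hp hR w hw hpw hvw => by
      have := hd.inCone.1 hpw
      exact ⟨by linarith, by linarith, hvw⟩)
  have := h.2.2.2 p hpc hp.1
  rw [h.2.1.le_iff hP hd hpc] at this
  linarith

/-- A competing vertex above the level of `v` is excluded by the empty gap or is farther than `x'`.
Below that level, `v` itself would be the nearer target; for a point far out there are no vertices
below. So the chain edge is extreme at `x'`, and nothing enters `x` from its negative cone opposite
to `C_j`: the local rule picks this edge from both ends. -/
lemma ChainSucc.kept_of_inCone (hP : GeneralPosition P) {i j k : Fin 3} (hd : Distinct3 i j k)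
    {v x x' : Plane} (hv : v ∈ P ∨ ∀ y ∈ P, coneCoord i v < coneCoord i y)
    (h : ChainSucc P i j v x x') (hc : InCone k x x') :
    Kept P k x x' ∧ (∀ y ∈ P, Nearest P k y x' → coneCoord j y ≤ coneCoord j x) ∧
      ∀ y ∈ P, ¬ Nearest P j y x := by
  have hk := hd.rotate.rotate
  have hj := hd.rotate
  have cx := hd.inCone.1 h.1.2.1
  have cx' := hd.inCone.1 h.2.1.2.1
  have vx := h.1.2.1.lt
  have vx' := h.2.1.2.1.lt
  have c := hk.inCone.1 hc
  have cl := hc.lt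
  have hext : ∀ y ∈ P, Nearest P k y x' → coneCoord j y ≤ coneCoord j x := by
    intro y hy hn
    by_contra hlt
    rw [not_le] at hlt
    have hyc := hk.inCone.1 hn.2.1
    have hyv := h.gap_empty hP hd hy hlt hn.2.1.lt
    rcases hv with hv | hv
    · rcases eq_or_ne y v with rfl | hne
      · linarith
      have := lt_of_le_of_ne hyv (hP.coneCoord_ne hy hv hne i)
      have := hn.2.2 v hv (hk.inCone.2 ⟨this, by linarith⟩)
      linarith
    · exact (hv y hy).not_ge hyv
  refine ⟨⟨h.1.1, ⟨h.2.1.1, hc, fun w hw hxw => ?_⟩, .inl ⟨j, hd.2.2, hext⟩⟩, hext, ?_⟩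
  · by_contra hlt
    have cw := hk.inCone.1 hxw
    have := h.gap_empty hP hd hw cw.2 (not_le.1 hlt)
    linarith
  · intro y hy hn
    have hyc := hj.inCone.1 hn.2.1
    have hyl := hn.2.1.lt
    rcases le_or_gt (coneCoord i y) (coneCoord i v) with hyv | hyv
    · rcases hv with hv | hv
      · rcases eq_or_ne y v with rfl | hne
        · linarith
        have := lt_of_le_of_ne hyv (hP.coneCoord_ne hy hv hne i)
        have := hn.2.2 v hv (hj.inCone.2 ⟨by linarith, this⟩)
        linarith
      · exact (hv y hy).not_ge hyv
    · have hle : coneCoord k y ≤ coneCoord k x' := by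
        by_contra hlt
        exact (h.gap_empty hP hd hy hyl (not_le.1 hlt)).not_gt hyv
      have hne : y ≠ x' := by rintro rfl; linarith
      have := lt_of_le_of_ne hle (hP.coneCoord_ne hy h.2.1.1 hne k)
      have := hn.2.2 x' h.2.1.1 (hj.inCone.2 ⟨this, by linarith⟩)
      linarith

lemma ChainSucc.isNext_of_inCone (hP : GeneralPosition P) {i j k : Fin 3} (hd : Distinct3 i j k)
    {v x x' : Plane} (hv : v ∈ P ∨ ∀ y ∈ P, coneCoord i v < coneCoord i y)
    (h : ChainSucc P i j v x x') (hc : InCone k x x') :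
    IsNext (nbhd P x) j k x x' ∧ IsNext (nbhd P x') k j x' x := by
  obtain ⟨h1, h2, h3⟩ := h.kept_of_inCone hP hd hv hc
  constructor
  · refine .inr ⟨fun z hz hzx => ?_, hP.mem_nbhd_inCone.2 h1⟩
    have := hP.mem_nbhd_inCone_swap.1 ⟨hz, hzx⟩
    exact h3 z this.1 this.2.1
  · refine .inl ⟨(hP.mem_nbhd_inCone_swap.2 h1).1, hc, fun z hz hzx => ?_⟩
    have := hP.mem_nbhd_inCone_swap.1 ⟨hz, hzx⟩
    exact h2 z this.1 this.2.1

/-- The sign of the change in coordinate `i` decides which endpoint owns the edge; the second case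
is the first one read backwards along the chain. -/
lemma ChainSucc.isNext (hP : GeneralPosition P) {i j k : Fin 3} (hd : Distinct3 i j k)
    {v x x' : Plane} (hv : v ∈ P ∨ ∀ y ∈ P, coneCoord i v < coneCoord i y)
    (h : ChainSucc P i j v x x') : IsNext (nbhd P x) j k x x' := by
  have hlt := (h.1.lt_iff hP hd h.2.1).1 h.2.2.1
  have hne : x ≠ x' := by rintro rfl; exact lt_irrefl _ hlt
  rcases lt_or_gt_of_ne (hP.coneCoord_ne h.1.1 h.2.1.1 hne i) with hi | hi
  · exact (h.isNext_of_inCone hP hd hv (hd.rotate.rotate.inCone.2 ⟨hi, h.2.2.1⟩)).1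
  · exact ((h.swap hP hd).isNext_of_inCone hP hd.swap hv (hd.rotate.inCone.2 ⟨hlt, hi⟩)).2

lemma IsNext.lt (hP : GeneralPosition P) {i j k : Fin 3} (hd : Distinct3 i j k) {x y : Plane}
    (h : IsNext (nbhd P x) j k x y) :
    y ∈ P ∧ coneCoord j x < coneCoord j y ∧ coneCoord k y < coneCoord k x := by
  rcases h with ⟨h1, h2, -⟩ | ⟨-, h1, h2⟩
  · exact ⟨(hP.mem_nbhd_inCone_swap.1 ⟨h1, h2⟩).1, h2.lt, h2 k hd.2.2.symm⟩
  · exact ⟨(hP.mem_nbhd_inCone.1 ⟨h1, h2⟩).2.1.1, h2 j hd.2.2, h2.lt⟩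

/-- With an anchor far out, the end of the chain is recognized because the rule finds no successor.
With a vertex as anchor this is not needed: the chain ends have kept edges and see the anchor. -/
lemma not_isNext_of_max (hP : GeneralPosition P) {i j k : Fin 3} (hd : Distinct3 i j k)
    {v x y : Plane} (hv : ∀ y ∈ P, InCone i y v ∧ coneCoord i v < coneCoord i y)
    (hmax : ∀ z, OnChain P i v z → coneCoord j z ≤ coneCoord j x) :
    ¬ IsNext (nbhd P x) j k x y := by
  intro h
  obtain ⟨hy, hlt, -⟩ := h.lt hP hd
  obtain ⟨p, hp, hpc⟩ := exists_onChain_of_region (i := i) (v := v)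
    (R := fun p => coneCoord j x < coneCoord j p) hy hlt (fun p hp _ => (hv p hp).1)
    (fun p _ hR w _ hpw _ => hR.trans (hpw j hd.1.symm))
  exact (hmax p hpc).not_gt hp

/-- If no vertex lies in the cone `C_i` of `s`, then `s` is on the chain of a point far out. -/
lemma exists_virtual_anchor (P : Finset Plane) (i : Fin 3) :
    ∃ v : Plane, ∀ y ∈ P, InCone i y v ∧ coneCoord i v < coneCoord i y := by
  have d0 : Distinct3 0 1 2 := by unfold Distinct3; decide
  classical
  obtain ⟨M, hM⟩ : ∃ M : ℝ, ∀ y ∈ P, ∀ l, |coneCoord l y| < M := by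
    obtain ⟨M, hM⟩ := (P ×ˢ (Finset.univ : Finset (Fin 3))).image (fun q => |coneCoord q.2 q.1|)
      |>.exists_le
    refine ⟨M + 1, fun y hy l => ?_⟩
    have := hM |coneCoord l y| (Finset.mem_image.2
      ⟨(y, l), Finset.mem_product.2 ⟨hy, Finset.mem_univ l⟩, rfl⟩)
    linarith
  -- The coordinates `-2M, M, M` sum to zero; the witness inverts the coordinate map.
  have hv : ∃ v : Plane, ∀ l, coneCoord l v = if l = i then - (2 * M) else M := by
    refine ⟨!₂[((if (1 : Fin 3) = i then - (2 * M) else M) - (if 2 = i then - (2 * M) else M)) / 2,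
      - √3 / 2 * (if 0 = i then - (2 * M) else M)], fun l => ?_⟩
    have h0 : (√3 : ℝ) ≠ 0 := by positivity
    fin_cases i <;> fin_cases l <;> simp [coneCoord] <;> field_simp <;> ring
  obtain ⟨v, hv⟩ := hv
  refine ⟨v, fun y hy => ⟨fun j hj => ?_, ?_⟩⟩
  · rw [hv, if_neg hj]; exact (abs_lt.1 (hM y hy j)).2
  · rw [hv, if_pos rfl]
    have := abs_lt.1 (hM y hy i)
    have := abs_nonneg (coneCoord i y)
    have := hM y hy i
    linarith

end

/-! ### The routing algorithm and its memory. -/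

noncomputable section

section RoutingDefs
open scoped Classical

/-- The control state of the routing algorithm. A flag `some j` records that the side region in the
cone `C_j` of the current vertex is known to be empty. -/
inductive RState : Type
  | idle (flag : Option (Fin 3))
  | search (i j : Fin 3) (flag : Option (Fin 3)) (org : Plane) (oth : Option Plane)
  | back (i : Fin 3) (org : Plane)
  | walk (i j : Fin 3) (flag : Option (Fin 3))

/-- The index different from two distinct indices. -/
def third (i j : Fin 3) : Fin 3 := -(i + j)

/-- The signed position of `z` relative to `s` on a chain, growing in direction `j`. -/
def offset (i j : Fin 3) (s z : Plane) : ℝ :=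
  (coneCoord j z - coneCoord (third i j) z) - (coneCoord j s - coneCoord (third i j) s)

/-- The next vertex on a chain in the cone `C_i` in direction `j`, if any. -/
def nextVertex (N : Set Plane) (i j : Fin 3) (x : Plane) : Option Plane :=
  if h : ∃ y, IsNext N j (third i j) x y then some h.choose else none

/-- The next vertex, unless it is farther than `B` from the origin `s` of the search. -/
def boundedNext (N : Set Plane) (i j : Fin 3) (s : Plane) (B : ℝ) (x : Plane) : Option Plane :=
  (nextVertex N i j x).filter fun y => decide (offset i j s y ≤ B)

/-- The flag after reaching `v` from `s`: coming from a positive cone, the side that was covered by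
the empty triangle of `s` and `v` is known to be empty. -/
def newFlag (i : Fin 3) (f : Option (Fin 3)) (s t v : Plane) : Option (Fin 3) :=
  if InCone i s t then
    if h : ∃ k, InCone k t v then some (third i h.choose) else none
  else f

/-- Return along the chain to the origin `s` of a search; at `s` continue with `fb`. -/
def backStep (fb : Plane × RState) (N : Set Plane) (i : Fin 3) (s x : Plane) : Plane × RState :=
  if x = s then fb
  else ((nextVertex N i (if coneCoord (i + 1) x < coneCoord (i + 1) s then i + 1 else i + 2)
    x).getD x, .back i s)

/-- One step of the doubling search from `s` for the nearest vertex in the cone `C_i` of `s`. -/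
def searchStep (fb : Plane × RState) (N : Set Plane) (t x : Plane) (i j : Fin 3)
    (f : Option (Fin 3)) (s : Plane) (o : Option Plane) : Plane × RState :=
  if h : ∃ y ∈ N, InCone i x y then
    if coneCoord i t ≤ coneCoord i h.choose then
      (h.choose, .idle (newFlag i f s t h.choose))
    else backStep fb N i s x
  else
    let nx := boundedNext N i j s (2 * (coneCoord i s - coneCoord i t)) x
    if nx.isSome ∧ ∀ a ∈ o, offset i j s (nx.getD x) ≤ 2 * offset i (third i j) s a then
      (nx.getD x, .search i j f s o)
    else if o.isSome then ((nextVertex N i (third i j) x).getD x, .search i (third i j) f s nx)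
    else backStep fb N i s x

/-- The first step of a search. -/
def startSearch (fb : Plane × RState) (N : Set Plane) (t s : Plane) (i : Fin 3)
    (f : Option (Fin 3)) : Plane × RState :=
  searchStep fb N t s i (i + 1) f s
    (boundedNext N i (i + 2) s (2 * (coneCoord i s - coneCoord i t)) s)

/-- Towards `t` in the negative cone of `s` opposite to `C_i`: move to a neighbour in that cone that
lies above `t`, if there is one, and choose the extreme one away from direction `j`. -/
def descend (N : Set Plane) (t s : Plane) (i j : Fin 3) (f : Option (Fin 3)) :
    Option (Plane × RState) :=
  if h : ∃ y ∈ N, InCone i y s ∧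
      (∀ z ∈ N, InCone i z s → coneCoord (third i j) z ≤ coneCoord (third i j) y) ∧
      coneCoord j t ≤ coneCoord j y ∧ coneCoord (third i j) t ≤ coneCoord (third i j) y then
    some (h.choose, .idle f)
  else if h : ∃ c ∈ N, InCone i c s ∧ (∀ z ∈ N, InCone i z s → coneCoord i c ≤ coneCoord i z) ∧
      (∃ z ∈ N, InCone i z s ∧ coneCoord j z < coneCoord j t) ∧
      ∃ z ∈ N, InCone i z s ∧ coneCoord j t ≤ coneCoord j z then
    some (h.choose, .walk i j f)
  else none

/-- A step towards `t` in the negative cone opposite to `C_i` when the side `j` is empty. -/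
def flagStep (N : Set Plane) (t s : Plane) (i j : Fin 3) : Plane × RState :=
  (descend N t s i j (some j)).getD
    (startSearch (s, .idle none) N t s (third i j) (some j))

/-- The direction of the smaller side region at `s`. -/
def smallSide (i : Fin 3) (t s : Plane) : Fin 3 :=
  if coneCoord (i + 1) s - coneCoord (i + 1) t ≤ coneCoord (i + 2) s - coneCoord (i + 2) t then
    i + 1 else i + 2

/-- A routing decision. -/
def idleStep (N : Set Plane) (t s : Plane) (f : Option (Fin 3)) : Plane × RState :=
  if h : ∃ i, InCone i s t then startSearch (s, .idle none) N t s h.choose none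
  else if h : ∃ i, InCone i t s then
    match f with
    | some j => flagStep N t s h.choose j
    -- The continuation after an immediate failure is passed to the search as a ready-made step,
    -- since staying at `s` for one step would not follow an edge.
    | none => (descend N t s h.choose (smallSide h.choose t s) none).getD
        (startSearch (flagStep N t s h.choose (smallSide h.choose t s)) N t s
          (smallSide h.choose t s) none)
  else (s, .idle none)

/-- One step of the walk along a chain to its extreme vertex on the near side of `t`. -/
def walkStep (N : Set Plane) (t x : Plane) (i j : Fin 3) (f : Option (Fin 3)) : Plane × RState :=
  if coneCoord j x < coneCoord j t then ((nextVertex N i j x).getD x, .walk i j f)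
  else if ∃ y ∈ nextVertex N i (third i j) x, coneCoord j t ≤ coneCoord j y then
    ((nextVertex N i (third i j) x).getD x, .walk i j f)
  else idleStep N t x f

/-- The transition function of the routing algorithm. -/
def routeStep (N : Set Plane) (t x : Plane) : RState → Plane × RState
  | .idle f => idleStep N t x f
  | .search i j f s o => searchStep (idleStep N t x (some i)) N t x i j f s o
  | .back i s => backStep (idleStep N t x (some i)) N i s x
  | .walk i j f => walkStep N t x i j f

/-- The vertices stored in a state. -/
def RState.PointsIn (P : Finset Plane) : RState → Prop
  | .search _ _ _ s o => s ∈ P ∧ ∀ a ∈ o, a ∈ P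
  | .back _ s => s ∈ P
  | _ => True

/-- The finite part of a state. -/
def RState.key : RState → Fin 4 × Fin 3 × Fin 3 × Option (Fin 3)
  | .idle f => (0, 0, 0, f)
  | .search i j f _ _ => (1, i, j, f)
  | .back i _ => (2, i, 0, none)
  | .walk i j f => (3, i, j, f)

/-- The stored vertices of a state. -/
def RState.pts : RState → Bool → Option Plane
  | .search _ _ _ s o => fun b => bif b then some s else o
  | .back _ s => fun b => bif b then some s else none
  | _ => fun _ => none

/-- The memory units, before numbering. -/
abbrev UnitIndex : Type := (Fin 4 × Fin 3 × Fin 3 × Option (Fin 3)) ⊕ Bool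

/-- The number of memory units. -/
def numUnits : ℕ := Fintype.card UnitIndex

/-- The memory contents that represent a state: the finite part in unary, and two vertices. -/
def RState.encode (st : RState) : Memory numUnits := fun r =>
  match (Fintype.equivFin UnitIndex).symm r with
  | .inl q => .int (if q = st.key then 1 else 0)
  | .inr b => ((st.pts b).map MemoryUnit.point).getD (.int 0)

/-- The state represented by memory contents. -/
def decode (M : Memory numUnits) : RState :=
  if h : ∃ st : RState, st.encode = M then h.choose else .idle none

/-- The routing algorithm. -/
def router : RoutingAlgorithm 1 numUnits where
  step s t N M := ((routeStep N t s (decode M)).1, (routeStep N t s (decode M)).2.encode)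

end RoutingDefs

lemma RState.encode_injective : Function.Injective RState.encode := by
  intro a b h
  have H : ∀ u : UnitIndex, _ = _ := fun u => congrFun h (Fintype.equivFin UnitIndex u)
  simp only [RState.encode, Equiv.symm_apply_apply] at H
  have hkey : a.key = b.key := by
    have := H (.inl a.key)
    simpa using this
  have hpts : ∀ c, a.pts c = b.pts c := by
    intro c
    have := H (.inr c)
    simp only at this
    generalize a.pts c = x at this ⊢
    generalize b.pts c = y at this ⊢
    cases x <;> cases y <;> simp_all
  have h1 := hpts true
  have h2 := hpts false
  cases a <;> cases b <;> simp_all [RState.key, RState.pts]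

lemma decode_encode (st : RState) : decode st.encode = st := by
  have h : ∃ st' : RState, st'.encode = st.encode := ⟨st, rfl⟩
  rw [decode, dif_pos h]
  exact RState.encode_injective h.choose_spec

/-- Every encoded state has a 1 in the unit of its key, so the all-zero memory encodes no state and
falls to the default. -/
lemma decode_zero : decode (fun _ => MemoryUnit.int 0) = .idle none := by
  rw [decode, dif_neg]
  rintro ⟨st, h⟩
  have := congrFun h (Fintype.equivFin UnitIndex (.inl st.key))
  simp [RState.encode] at this

lemma RState.encode_admissible {P : Finset Plane} (hc : 1 < P.card) {st : RState}
    (h : st.PointsIn P) (r : Fin numUnits) : (st.encode r).Admissible P := by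
  obtain ⟨u, rfl⟩ := (Fintype.equivFin UnitIndex).surjective r
  simp only [RState.encode, Equiv.symm_apply_apply]
  rcases u with q | b
  -- The unary digits are 0 and 1, which is admissible once there are two vertices.
  · simp only [MemoryUnit.Admissible]
    split_ifs <;> omega
  · have hp : ∀ p, st.pts b = some p → p ∈ P := by
      intro p
      cases st <;> cases b <;> simp [RState.pts, RState.PointsIn] at h ⊢
      · exact h.2 p
      · rintro rfl; exact h.1
      · rintro rfl; exact h
    change (((st.pts b).map MemoryUnit.point).getD (.int 0)).Admissible P
    cases e : st.pts b with
    | none => change 0 < P.card; omega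
    | some p => exact hp p e

/-! ### Runs of the algorithm and their lengths. -/

variable {P : Finset Plane} {t : Plane}

/-- Position and state after one more step on `G₁₂`. -/
def advance (P : Finset Plane) (t : Plane) (c : Plane × RState) : Plane × RState :=
  routeStep (nbhd P c.1) t c.1 c.2

/-- Routing to `t` leads from `c` to `d` with total distance `L`. -/
inductive Trip (P : Finset Plane) (t : Plane) (c : Plane × RState) : Plane × RState → ℝ → Prop
  | refl : c.1 ∈ P → c.2.PointsIn P → Trip P t c c 0
  | snoc {d : Plane × RState} {L : ℝ} : Trip P t c d L →
      (GTwelve P).Adj d.1 (advance P t d).1 → (advance P t d).2.PointsIn P →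
      Trip P t c (advance P t d) (L + dist d.1 (advance P t d).1)

/-- Routing from `c` arrives at `t` with total distance at most `L`. -/
def Arrives (P : Finset Plane) (t : Plane) (c : Plane × RState) (L : ℝ) : Prop :=
  ∃ d L', Trip P t c d L' ∧ d.1 = t ∧ L' ≤ L

lemma Trip.trans {c d e : Plane × RState} {L L' : ℝ} (h : Trip P t c d L) (h' : Trip P t d e L') :
    Trip P t c e (L + L') := by
  induction h' with
  | refl => simpa using h
  | snoc _ ha hp ih => rw [← add_assoc]; exact .snoc ih ha hp

lemma Trip.pointsIn {c d : Plane × RState} {L : ℝ} (h : Trip P t c d L) : d.2.PointsIn P := by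
  cases h <;> assumption

lemma Trip.snoc' {c d e : Plane × RState} {L : ℝ} (h : Trip P t c d L) (he : advance P t d = e)
    (ha : (GTwelve P).Adj d.1 e.1) (hp : e.2.PointsIn P) : Trip P t c e (L + dist d.1 e.1) := by
  subst he; exact .snoc h ha hp

lemma Trip.mem {c d : Plane × RState} {L : ℝ} (h : Trip P t c d L) : d.1 ∈ P := by
  cases h with
  | refl h => exact h
  | snoc _ h _ => exact h.1.2.1

/-- Only the position and the next step of the initial configuration matter. -/
lemma Trip.change_start {c d e : Plane × RState} {L : ℝ} (h : Trip P t c d L) (h1 : e.1 = c.1)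
    (h2 : advance P t e = advance P t c) (hp : e.2.PointsIn P) :
    (d = c ∧ L = 0) ∨ Trip P t e d L := by
  induction h with
  | refl => exact .inl ⟨rfl, rfl⟩
  | snoc h ha hq ih =>
    right
    rcases ih with ⟨rfl, rfl⟩ | ih
    · have h0 := h.mem
      rw [← h1, ← h2] at ha ⊢
      rw [← h1] at h0
      exact .snoc (.refl h0 hp) ha (h2 ▸ hq)
    · exact .snoc ih ha hq

/-- Two runs can be joined when position and next step agree. Equality of states would be too
strong: a finished walk or return still carries its own state, although it then acts like an idle
one. -/
lemma Trip.arrives {c d e : Plane × RState} {L L' : ℝ} (h : Trip P t c d L) (h1 : d.1 = e.1)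
    (h2 : advance P t d = advance P t e) (he : Arrives P t e L') : Arrives P t c (L + L') := by
  obtain ⟨f, M, hf, hft, hM⟩ := he
  rcases hf.change_start h1 h2 h.pointsIn with ⟨rfl, rfl⟩ | hf
  · exact ⟨d, L, h, h1.trans hft, by linarith⟩
  · exact ⟨f, L + M, h.trans hf, hft, by linarith⟩

lemma Arrives.mono {c : Plane × RState} {L L' : ℝ} (h : Arrives P t c L) (hL : L ≤ L') :
    Arrives P t c L' := by
  obtain ⟨d, M, h1, h2, h3⟩ := h
  exact ⟨d, M, h1, h2, h3.trans hL⟩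

lemma Trip.iterate {c d : Plane × RState} {L : ℝ} (h : Trip P t c d L) :
    ∃ n, (advance P t)^[n] c = d ∧
      (∀ j < n, (GTwelve P).Adj ((advance P t)^[j] c).1 ((advance P t)^[j + 1] c).1) ∧
      (∀ j ≤ n, ((advance P t)^[j] c).2.PointsIn P) ∧
      ∑ j ∈ Finset.range n, dist ((advance P t)^[j] c).1 ((advance P t)^[j + 1] c).1 = L := by
  induction h with
  | refl h1 h2 =>
    refine ⟨0, rfl, by simp, fun j hj => ?_, by simp⟩
    obtain rfl : j = 0 := by omega
    exact h2
  | @snoc d L h ha hp ih =>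
    obtain ⟨n, e, h1, h2, h3⟩ := ih
    have e' : (advance P t)^[n + 1] c = advance P t d := by
      rw [Function.iterate_succ_apply', e]
    refine ⟨n + 1, e', fun j hj => ?_, fun j hj => ?_, ?_⟩
    · rcases Nat.lt_succ_iff_lt_or_eq.1 hj with hj | rfl
      · exact h1 j hj
      · rw [e', e]; exact ha
    · rcases Nat.lt_or_eq_of_le hj with hj | rfl
      · exact h2 j (by omega)
      · rw [e']; exact hp
    · rw [Finset.sum_range_succ, h3, e', e]

lemma router_run (P : Finset Plane) (s t : Plane) (j : ℕ) :
    (router.run (GTwelve P) s t j).1 = ((advance P t)^[j] (s, .idle none)).1 ∧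
      decode (router.run (GTwelve P) s t j).2 = ((advance P t)^[j] (s, .idle none)).2 ∧
      (0 < j → (router.run (GTwelve P) s t j).2
        = ((advance P t)^[j] (s, .idle none)).2.encode) := by
  induction j with
  | zero => exact ⟨rfl, decode_zero, fun h => absurd h (lt_irrefl _)⟩
  | succ j ih =>
    obtain ⟨h1, h2, -⟩ := ih
    have e1 : (router.run (GTwelve P) s t (j + 1)).1
        = ((advance P t)^[j + 1] (s, .idle none)).1 := by
      rw [Function.iterate_succ_apply', RoutingAlgorithm.run]
      simp only [router, advance] at h1 h2 ⊢
      rw [h1, h2]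
    have e2 : (router.run (GTwelve P) s t (j + 1)).2
        = ((advance P t)^[j + 1] (s, .idle none)).2.encode := by
      rw [Function.iterate_succ_apply', RoutingAlgorithm.run]
      simp only [router, advance] at h1 h2 ⊢
      rw [h1, h2]
    exact ⟨e1, by rw [e2, decode_encode], fun _ => e2⟩

lemma Arrives.deliversWithin {s : Plane} {L : ℝ} (hc : 1 < P.card)
    (h : Arrives P t (s, .idle none) L) : router.DeliversWithin P (GTwelve P) s t L := by
  obtain ⟨d, L', hd, hdt, hL⟩ := h
  obtain ⟨n, e, h1, h2, h3⟩ := hd.iterate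
  refine ⟨n, ?_, fun j hj => ?_, fun j hj r => ?_, ?_⟩
  · rw [(router_run P s t n).1, e, hdt]
  · rw [(router_run P s t j).1, (router_run P s t (j + 1)).1]
    exact h1 j hj
  · rcases Nat.eq_zero_or_pos j with rfl | hpos
    · change (0 : ℕ) < P.card
      omega
    · rw [(router_run P s t j).2.2 hpos]
      exact RState.encode_admissible hc (h2 j hj) r
  · refine le_trans (le_of_eq ?_) hL
    rw [← h3]
    exact Finset.sum_congr rfl fun j _ => by
      rw [(router_run P s t j).1, (router_run P s t (j + 1)).1]

end

/-! ### The doubling search: geometry on a chain and one step. -/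

noncomputable section

variable {P : Finset Plane} {t : Plane}

lemma distinct3_third {i j : Fin 3} (h : i ≠ j) : Distinct3 i j (third i j) := by
  revert i j; unfold Distinct3 third; decide

lemma third_third (i j : Fin 3) : third i (third i j) = j := by
  revert i j; unfold third; decide

lemma Distinct3.third_eq {i j k : Fin 3} (h : Distinct3 i j k) : third i j = k := by
  revert i j k; unfold Distinct3 third; decide

lemma finset_induction_real {α : Type*} (P : Finset α) (f : α → ℝ) (Q : α → Prop)
    (H : ∀ x ∈ P, (∀ y ∈ P, f y < f x → Q y) → Q x) : ∀ x ∈ P, Q x := by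
  classical
  by_contra! hc
  obtain ⟨x, hx, hQ⟩ := hc
  obtain ⟨y, hy, hmin⟩ := (P.filter fun x => ¬ Q x).exists_min_image f
    ⟨x, Finset.mem_filter.2 ⟨hx, hQ⟩⟩
  rw [Finset.mem_filter] at hy
  refine hy.2 (H y hy.1 fun z hz hlt => ?_)
  by_contra hQz
  exact (hmin z (Finset.mem_filter.2 ⟨hz, hQz⟩)).not_gt hlt

lemma exists_min_dist (P : Finset Plane) : ∃ δ > 0, ∀ x ∈ P, ∀ y ∈ P, x ≠ y → δ ≤ dist x y := by
  classical
  rcases ((P ×ˢ P).filter fun q => q.1 ≠ q.2).eq_empty_or_nonempty with h | h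
  · refine ⟨1, one_pos, fun x hx y hy hne => ?_⟩
    have : (x, y) ∈ (P ×ˢ P).filter fun q => q.1 ≠ q.2 := by simp [hx, hy, hne]
    simp [h] at this
  · obtain ⟨q, hq, hmin⟩ := Finset.exists_min_image _ (fun q => dist q.1 q.2) h
    simp only [Finset.mem_filter] at hq
    exact ⟨_, dist_pos.2 hq.2, fun x hx y hy hne => hmin (x, y) (by simp [hx, hy, hne])⟩

lemma offset_self (i j : Fin 3) (s : Plane) : offset i j s s = 0 := sub_self _

lemma offset_third (i j : Fin 3) (s z : Plane) : offset i (third i j) s z = - offset i j s z := by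
  rw [offset, offset, third_third]; ring

lemma OnChain.offset_lt_iff (hP : GeneralPosition P) {i j : Fin 3} (hij : i ≠ j) {v x y : Plane}
    (s : Plane) (hx : OnChain P i v x) (hy : OnChain P i v y) :
    offset i j s x < offset i j s y ↔ coneCoord j x < coneCoord j y := by
  have hd := distinct3_third hij
  have h := hx.lt_iff hP hd hy
  have h' := hx.le_iff hP hd hy
  constructor
  · intro hlt
    by_contra hc
    have e := (hy.le_iff hP hd hx).1 (not_lt.1 hc)
    unfold offset at hlt
    linarith
  · intro hlt
    have e := h.1 hlt
    unfold offset
    linarith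

lemma OnChain.eq_of_offset_eq (hP : GeneralPosition P) {i j : Fin 3} (hij : i ≠ j)
    {v x y : Plane} (s : Plane) (hx : OnChain P i v x) (hy : OnChain P i v y)
    (h : offset i j s x = offset i j s y) : x = y := by
  by_contra hne
  rcases lt_or_gt_of_ne (hP.coneCoord_ne hx.1 hy.1 hne j) with hl | hl
  · exact ((hx.offset_lt_iff hP hij s hy).2 hl).ne h
  · exact ((hy.offset_lt_iff hP hij s hx).2 hl).ne' h

/-- Along a chain one coordinate grows while the other falls, so the offset difference is the sum of
both absolute changes, which dominates the Euclidean distance. -/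
lemma OnChain.dist_le (hP : GeneralPosition P) {i j : Fin 3} (hij : i ≠ j)
    {v x y : Plane} (s : Plane) (hx : OnChain P i v x) (hy : OnChain P i v y) :
    dist x y ≤ |offset i j s x - offset i j s y| := by
  have hd := distinct3_third hij
  refine (dist_le_add hd x y).trans (le_of_eq ?_)
  rcases lt_trichotomy (coneCoord j x) (coneCoord j y) with h | h | h
  · have e := (hx.lt_iff hP hd hy).1 h
    rw [abs_of_pos (by linarith), abs_of_neg (by linarith),
      abs_of_neg (by unfold offset; linarith)]
    unfold offset; ring
  · have : x = y := by
      by_contra hne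
      exact hP.coneCoord_ne hx.1 hy.1 hne j h
    simp [this]
  · have e := (hy.lt_iff hP hd hx).1 h
    rw [abs_of_neg (by linarith), abs_of_pos (by linarith),
      abs_of_pos (by unfold offset; linarith)]
    unfold offset; ring

lemma nextVertex_eq (hP : GeneralPosition P) {i j : Fin 3} {x y : Plane}
    (h : IsNext (nbhd P x) j (third i j) x y) : nextVertex (nbhd P x) i j x = some y := by
  have h' : ∃ y, IsNext (nbhd P x) j (third i j) x y := ⟨y, h⟩
  rw [nextVertex, dif_pos h', h'.choose_spec.unique hP h]

/-- `v` is an anchor: a vertex or a point far out in the cones `C_i` of all vertices. -/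
def Anchor (P : Finset Plane) (i : Fin 3) (v : Plane) : Prop :=
  v ∈ P ∨ ∀ y ∈ P, InCone i y v ∧ coneCoord i v < coneCoord i y

lemma ChainSucc.next_eq (hP : GeneralPosition P) {i j : Fin 3} (hij : i ≠ j) {v x x' : Plane}
    (hv : Anchor P i v) (h : ChainSucc P i j v x x') :
    nextVertex (nbhd P x) i j x = some x' ∧ (GTwelve P).Adj x x' := by
  have := h.isNext hP (distinct3_third hij) (hv.imp_right fun H y hy => (H y hy).2)
  exact ⟨nextVertex_eq hP this, this.adj hP⟩

lemma OnChain.eq_of_kept (hP : GeneralPosition P) {i : Fin 3} {v x y : Plane} (hv : Anchor P i v)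
    (hx : OnChain P i v x) (h : Kept P i x y) : y = v ∧ v ∈ P := by
  rcases hv with hv | hv
  · exact ⟨h.2.1.unique hP ((onChain_iff_nearest hv).1 hx).2, hv⟩
  · exact absurd (hx.2.2 y h.2.1.1 h.2.1.2.1) (hv y h.2.1.1).2.not_ge

lemma OnChain.exists_gt_of_not_kept {i j : Fin 3} (hij : i ≠ j) {v x : Plane}
    (hx : OnChain P i v x) (hv : v ∈ P) (h : ¬ Kept P i x v) :
    ∃ z, OnChain P i v z ∧ coneCoord j x < coneCoord j z := by
  by_contra! hc
  refine h ⟨hx.1, ((onChain_iff_nearest hv).1 hx).2, .inl ⟨j, hij.symm, fun y hy hn => ?_⟩⟩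
  exact hc y ((onChain_iff_nearest hv).2 ⟨hy, hn⟩)

/-- The chain of a vertex cannot end at `x`, since an extreme neighbour is kept; so a missing
bounded successor means that all later chain vertices lie beyond `B`. -/
lemma boundedNext_cases (hP : GeneralPosition P) {i j : Fin 3} (hij : i ≠ j) {v x : Plane}
    (hv : Anchor P i v) (s : Plane) (B : ℝ) (hx : OnChain P i v x) (h : ¬ Kept P i x v) :
    (∃ x', ChainSucc P i j v x x' ∧ offset i j s x' ≤ B ∧
      boundedNext (nbhd P x) i j s B x = some x') ∨
    (boundedNext (nbhd P x) i j s B x = none ∧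
      ∀ z, OnChain P i v z → offset i j s x < offset i j s z → B < offset i j s z) := by
  by_cases hz : ∃ z, OnChain P i v z ∧ coneCoord j x < coneCoord j z
  · obtain ⟨z, hz, hlt⟩ := hz
    obtain ⟨x', hs⟩ := hx.exists_succ hz hlt
    rw [boundedNext, (hs.next_eq hP hij hv).1]
    by_cases hB : offset i j s x' ≤ B
    · exact .inl ⟨x', hs, hB, by simp [hB]⟩
    · refine .inr ⟨by simpa using hB, fun z hz hlt => ?_⟩
      rw [hx.offset_lt_iff hP hij s hz] at hlt
      have h1 := hs.2.2.2 z hz hlt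
      have h2 : ¬ offset i j s z < offset i j s x' := by
        rw [hz.offset_lt_iff hP hij s hs.2.1]; exact h1.not_gt
      linarith
  · have hv' := hv.resolve_left fun hv => hz (hx.exists_gt_of_not_kept hij hv h)
    push Not at hz
    have hn : nextVertex (nbhd P x) i j x = none := by
      rw [nextVertex, dif_neg]
      rintro ⟨y, hy⟩
      exact not_isNext_of_max hP (distinct3_third hij) hv' hz hy
    refine .inr ⟨by rw [boundedNext, hn]; rfl, fun z hzc hlt => ?_⟩
    rw [hx.offset_lt_iff hP hij s hzc] at hlt
    exact absurd hlt (hz z hzc).not_gt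

/-- The invariant of the doubling search from `s` on the chain of `v`, at `x`, in direction `j`, with
the next unvisited vertex `o` on the other side and after a projected distance `W`. -/
structure SearchInv (P : Finset Plane) (i : Fin 3) (v s : Plane) (B : ℝ) (j : Fin 3) (x : Plane)
    (o : Option Plane) (W : ℝ) : Prop where
  ne : i ≠ j
  onChain : OnChain P i v x
  ahead : ∀ z, Kept P i z v → OnChain P i v z → 0 < offset i j s z →
    offset i j s x ≤ offset i j s z ∧ W ≤ offset i j s x + 8 * offset i j s z
  behind : ∀ z, Kept P i z v → OnChain P i v z → offset i j s z < 0 →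
    (∀ a ∈ o, offset i j s z ≤ offset i j s a) ∧ (o = none → offset i j s z < -B)
  other : ∀ a ∈ o, OnChain P i v a ∧ offset i j s a < 0 ∧ -B ≤ offset i j s a ∧
    offset i j s x ≤ -(2 * offset i j s a) ∧ W ≤ offset i j s x - 4 * offset i j s a ∧
    offset i j s a < offset i j s x
  bounds : W ≤ offset i j s x + 8 * B ∧ offset i j s x ≤ B ∧ -B ≤ offset i j s x

/-- The outcome of a search step at an invisible chain vertex: the search moves on, or it is given
up because nothing is visible within distance `B`. -/
def SearchMoves (P : Finset Plane) (i : Fin 3) (v s : Plane) (B : ℝ) (j : Fin 3) (x : Plane) (W : ℝ)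
    (f : Option (Fin 3)) (r : Plane × RState) : Prop :=
  ∃ j' x' o', r = (x', .search i j' f s o') ∧ (∀ a ∈ o', a ∈ P) ∧
    SearchInv P i v s B j' x' o' (W + |offset i j s x - offset i j s x'|) ∧
    (GTwelve P).Adj x x'

lemma ChainSucc.offset_le (hP : GeneralPosition P) {i j : Fin 3} (hij : i ≠ j) {v x x' z : Plane}
    (s : Plane) (h : ChainSucc P i j v x x') (hz : OnChain P i v z)
    (hlt : offset i j s x < offset i j s z) : offset i j s x' ≤ offset i j s z := by
  rw [h.1.offset_lt_iff hP hij s hz] at hlt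
  rw [← not_lt, hz.offset_lt_iff hP hij s h.2.1]
  exact (h.2.2.2 z hz hlt).not_gt

lemma ChainSucc.offset_lt (hP : GeneralPosition P) {i j : Fin 3} (hij : i ≠ j) {v x x' : Plane}
    (s : Plane) (h : ChainSucc P i j v x x') : offset i j s x < offset i j s x' :=
  (h.1.offset_lt_iff hP hij s h.2.1).2 h.2.2.1

lemma SearchInv.ahead_lt (hP : GeneralPosition P) {i j : Fin 3} {v s x : Plane} {B W : ℝ}
    {o : Option Plane} (hI : SearchInv P i v s B j x o W) (hxv : ¬ Kept P i x v) {z : Plane}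
    (hz : Kept P i z v) (hzc : OnChain P i v z) (h0 : 0 < offset i j s z) :
    offset i j s x < offset i j s z := by
  refine lt_of_le_of_ne (hI.ahead z hz hzc h0).1 fun e => ?_
  exact hxv (hI.onChain.eq_of_offset_eq hP hI.ne s hzc e ▸ hz)

/-- The arithmetic of doubling. By the invariant the distance so far is at most `x + 4|a|` with `x ≤
2|a|`; walking back to `y` gives at most `y' + 8|a|` in the new direction, where `y'` is the new
offset, and `a` bounds every unexplored candidate there. A turn before `n` requires `n > 2|a|`, so
the same quantity is at most `y' + 4n`, which restores the invariant. -/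
lemma SearchInv.turn (hP : GeneralPosition P) {i j : Fin 3} {v s x a : Plane} {B W : ℝ}
    {o nx : Option Plane} {f : Option (Fin 3)} (hv : Anchor P i v)
    (hI : SearchInv P i v s B j x o W) (hxv : ¬ Kept P i x v) (ha : a ∈ o)
    (h0 : 0 ≤ offset i j s x)
    (hnx : ∀ n ∈ nx, OnChain P i v n ∧ offset i j s n ≤ B ∧
      -(2 * offset i j s a) < offset i j s n ∧ offset i j s x < offset i j s n ∧
      ∀ z, OnChain P i v z → offset i j s x < offset i j s z → offset i j s n ≤ offset i j s z)
    (hnone : nx = none → ∀ z, OnChain P i v z → offset i j s x < offset i j s z →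
      B < offset i j s z) :
    SearchMoves P i v s B j x W f
      ((nextVertex (nbhd P x) i (third i j) x).getD x, .search i (third i j) f s nx) := by
  have hij := hI.ne
  have hik := (distinct3_third hij).2.1
  obtain ⟨a1, a2, a3, a4, a5, a6⟩ := hI.other a ha
  obtain ⟨b1, b2, b3⟩ := hI.bounds
  have hlt : coneCoord (third i j) x < coneCoord (third i j) a := by
    rw [← hI.onChain.offset_lt_iff hP hik s a1, offset_third, offset_third]; linarith
  obtain ⟨y, hy⟩ := hI.onChain.exists_succ a1 hlt
  have ya := hy.offset_le hP hik s a1 (by rw [offset_third, offset_third]; linarith)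
  have yx := hy.offset_lt hP hik s
  rw [offset_third, offset_third] at ya yx
  obtain ⟨e, hadj⟩ := hy.next_eq hP hik hv
  refine ⟨third i j, y, nx, by rw [e]; rfl, fun n hn => (hnx n hn).1.1, ?_, hadj⟩
  rw [abs_of_pos (by linarith)]
  constructor
  · exact hik
  · exact hy.2.1
  · intro z hz hzc hpos
    rw [offset_third] at hpos ⊢
    have := (hI.behind z hz hzc (by linarith)).1 a ha
    rw [offset_third]
    constructor <;> linarith
  · intro z hz hzc hneg
    rw [offset_third] at hneg ⊢
    have hlt := hI.ahead_lt hP hxv hz hzc (by linarith)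
    constructor
    · intro n hn
      rw [offset_third]
      have := (hnx n hn).2.2.2.2 z hzc hlt
      linarith
    · intro hn
      have := hnone hn z hzc hlt
      linarith
  · intro n hn
    obtain ⟨n1, n2, n3, n4, -⟩ := hnx n hn
    rw [offset_third, offset_third]
    refine ⟨n1, ?_, ?_, ?_, ?_, ?_⟩ <;> linarith
  · rw [offset_third]
    refine ⟨?_, ?_, ?_⟩ <;> linarith

lemma not_exists_visible (hP : GeneralPosition P) {i : Fin 3} {v x : Plane}
    (hv : Anchor P i v) (hx : OnChain P i v x) (hxv : ¬ Kept P i x v) :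
    ¬ ∃ y ∈ nbhd P x, InCone i x y := by
  rintro ⟨y, hy, hc⟩
  have := hP.mem_nbhd_inCone.1 ⟨hy, hc⟩
  exact hxv ((hx.eq_of_kept hP hv this).1 ▸ this)

lemma SearchInv.step (hP : GeneralPosition P) {i j : Fin 3} {v s x : Plane} {B W : ℝ}
    {o : Option Plane} {f : Option (Fin 3)} (hv : Anchor P i v) (hs : OnChain P i v s)
    (hsv : ¬ Kept P i s v) (hBpos : 0 < B) (hB : B = 2 * (coneCoord i s - coneCoord i t))
    (hI : SearchInv P i v s B j x o W) (hxv : ¬ Kept P i x v) (fb : Plane × RState) :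
    SearchMoves P i v s B j x W f (searchStep fb (nbhd P x) t x i j f s o) ∨
    (searchStep fb (nbhd P x) t x i j f s o = backStep fb (nbhd P x) i s x ∧
      ∀ z, Kept P i z v → OnChain P i v z → B < |offset i j s z|) := by
  have hij := hI.ne
  have hoP : ∀ a ∈ o, a ∈ P := fun a ha => (hI.other a ha).1.1
  have os := offset_self i j s
  rw [searchStep, dif_neg (not_exists_visible hP hv hI.onChain hxv), ← hB]
  rcases boundedNext_cases hP hij hv s B hI.onChain hxv with ⟨x', hsucc, hle, hnx⟩ | ⟨hnx, hnone⟩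
  · have hlt := hsucc.offset_lt hP hij s
    simp only [hnx, Option.isSome_some, true_and, Option.getD_some]
    by_cases hc : ∀ a ∈ o, offset i j s x' ≤ 2 * offset i (third i j) s a
    · left
      rw [if_pos hc]
      refine ⟨j, x', o, rfl, hoP, ?_, (hsucc.next_eq hP hij hv).2⟩
      rw [abs_of_neg (by linarith)]
      obtain ⟨b1, b2, b3⟩ := hI.bounds
      constructor
      · exact hij
      · exact hsucc.2.1
      · intro z hz hzc hpos
        have h1 := hsucc.offset_le hP hij s hzc (hI.ahead_lt hP hxv hz hzc hpos)
        have h2 := (hI.ahead z hz hzc hpos).2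
        constructor <;> linarith
      · exact hI.behind
      · intro a ha
        obtain ⟨a1, a2, a3, a4, a5, a6⟩ := hI.other a ha
        have := hc a ha
        rw [offset_third] at this
        refine ⟨a1, a2, a3, ?_, ?_, ?_⟩ <;> linarith
      · refine ⟨?_, ?_, ?_⟩ <;> linarith
    · left
      rw [if_neg hc]
      push Not at hc
      obtain ⟨a, ha, hgt⟩ := hc
      rw [offset_third] at hgt
      rw [if_pos (by rw [Option.mem_def.1 ha]; rfl)]
      refine hI.turn hP hv hxv ha ?_ ?_ (by simp)
      -- On the negative side of `s` the next chain vertex comes no later than `s`, so the doubling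
      -- bound could not be exceeded.
      · by_contra hneg
        have := hsucc.offset_le hP hij s hs (by linarith)
        have := (hI.other a ha).2.1
        linarith
      · rintro n hn
        obtain rfl : x' = n := by simpa using hn
        exact ⟨hsucc.2.1, hle, by linarith, hlt, fun z => hsucc.offset_le hP hij s⟩
  · simp only [hnx, Option.isSome_none, Bool.false_eq_true, false_and, if_false]
    cases o with
    | some a =>
      left
      rw [if_pos Option.isSome_some]
      refine hI.turn hP hv hxv (a := a) rfl ?_ (by simp) fun _ => hnone
      by_contra hneg
      have := hnone s hs (by linarith)
      linarith
    | none =>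
      right
      refine ⟨by simp, fun z hz hzc => ?_⟩
      rcases lt_trichotomy (offset i j s z) 0 with h | h | h
      · have := (hI.behind z hz hzc h).2 rfl
        rw [abs_of_neg h]; linarith
      · exact absurd (hzc.eq_of_offset_eq hP hij s hs (h.trans os.symm) ▸ hz) hsv
      · rw [abs_of_pos h]
        exact hnone z hzc (hI.ahead_lt hP hxv hz hzc h)

end

/-! ### The cost of a complete search. -/

noncomputable section

variable {P : Finset Plane} {t : Plane}

/-- A search from `s` for the anchor `v` in the cone `C_i`, begun at `c` and now at `d`, with an upper
bound `W` for the distance so far. -/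
def SearchAt (P : Finset Plane) (t : Plane) (i : Fin 3) (v s : Plane) (B : ℝ)
    (f : Option (Fin 3)) (fb : Plane × RState) (c d : Plane × RState) (W : ℝ)
    (fb' : Plane × RState) (j : Fin 3) (o : Option Plane) : Prop :=
  (∃ L, Trip P t c d L ∧ L ≤ W) ∧
    advance P t d = searchStep fb' (nbhd P d.1) t d.1 i j f s o ∧
    (d.1 = s → fb' = fb ∨ fb' = idleStep (nbhd P s) t s (some i)) ∧
    SearchInv P i v s B j d.1 o W

/-- Every move adds at least the minimum distance of `P` to `W`, while the invariant keeps `W ≤ 9B`.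
So the search stops. -/
lemma SearchAt.exists_end (hP : GeneralPosition P) {i : Fin 3} {v s : Plane} {B : ℝ}
    {f : Option (Fin 3)} {fb c : Plane × RState} (hv : Anchor P i v) (hs : OnChain P i v s)
    (hsv : ¬ Kept P i s v) (hBpos : 0 < B) (hB : B = 2 * (coneCoord i s - coneCoord i t))
    {d₀ fb₀ : Plane × RState} {W₀ : ℝ} {j₀ : Fin 3} {o₀ : Option Plane} (hW : 0 ≤ W₀)
    (h₀ : SearchAt P t i v s B f fb c d₀ W₀ fb₀ j₀ o₀) :
    ∃ d W fb' j o, SearchAt P t i v s B f fb c d W fb' j o ∧ (Kept P i d.1 v ∨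
      (advance P t d = backStep fb' (nbhd P d.1) i s d.1 ∧
        ∀ z, Kept P i z v → OnChain P i v z → B < |offset i j s z|)) := by
  obtain ⟨δ, hδ, hgap⟩ := exists_min_dist P
  by_contra hcon
  have key : ∀ n : ℕ, ∃ d W fb' j o, SearchAt P t i v s B f fb c d W fb' j o ∧ n * δ ≤ W := by
    intro n
    induction n with
    | zero => exact ⟨_, _, _, _, _, h₀, by simpa using hW⟩
    | succ n ih =>
      obtain ⟨d, W, fb', j, o, hd, hn⟩ := ih
      obtain ⟨⟨L, hT, hL⟩, he, hfb, hI⟩ := hd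
      have hk : ¬ Kept P i d.1 v := fun hk =>
        hcon ⟨d, W, fb', j, o, ⟨⟨L, hT, hL⟩, he, hfb, hI⟩, .inl hk⟩
      rcases hI.step (f := f) hP hv hs hsv hBpos hB hk fb' with hm | hm
      · obtain ⟨j', x', o', e, ho', hI', hadj⟩ := hm
        rw [← he] at e
        have hdist := hI.onChain.dist_le hP hI.ne s hI'.onChain
        have hge := hgap _ hI.onChain.1 _ hI'.onChain.1 hadj.ne
        refine ⟨(x', .search i j' f s o'), _, idleStep (nbhd P x') t x' (some i), j', o',
          ⟨⟨_, hT.snoc' e hadj ⟨hs.1, ho'⟩, ?_⟩, rfl, ?_, hI'⟩, ?_⟩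
        · exact add_le_add hL hdist
        · intro h
          simp only at h
          exact .inr (by rw [h])
        · push_cast; linarith
      · exact absurd ⟨d, W, fb', j, o, ⟨⟨L, hT, hL⟩, he, hfb, hI⟩, .inr ⟨he.trans hm.1, hm.2⟩⟩ hcon
  obtain ⟨n, hn⟩ := exists_nat_gt (9 * B / δ)
  obtain ⟨d, W, fb', j, o, hd, hle⟩ := key n
  rw [div_lt_iff₀ hδ] at hn
  have := hd.2.2.2.bounds
  linarith

lemma eq_or_eq_third {i j l : Fin 3} (hij : i ≠ j) (hl : i ≠ l) : l = j ∨ l = third i j := by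
  revert i j l; unfold third; decide

/-- Induction on the offset from `s`. The two alternatives for the continuation at `s` cover a
search that never left `s` and one that comes back in a search or return state. -/
lemma Trip.back (hP : GeneralPosition P) {i j : Fin 3} (hij : i ≠ j) {v s : Plane}
    {fb c : Plane × RState} (hv : Anchor P i v) (hs : OnChain P i v s) :
    ∀ x ∈ P, OnChain P i v x → ∀ (d fb' : Plane × RState) (L : ℝ), Trip P t c d L → d.1 = x →
      advance P t d = backStep fb' (nbhd P x) i s x →
      (x = s → fb' = fb ∨ fb' = idleStep (nbhd P s) t s (some i)) →
      ∃ d' L', Trip P t c d' L' ∧ d'.1 = s ∧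
        (advance P t d' = fb ∨ advance P t d' = idleStep (nbhd P s) t s (some i)) ∧
        L' ≤ L + |offset i j s x| := by
  have habs : ∀ l, i ≠ l → ∀ z, |offset i l s z| = |offset i j s z| := by
    intro l hl z
    rcases eq_or_eq_third hij hl with rfl | rfl
    · rfl
    · rw [offset_third, abs_neg]
  refine finset_induction_real P (fun x => |offset i j s x|) _ ?_
  intro x hx ih hxc d fb' L hT hdx he hfb
  by_cases hxs : x = s
  · subst hxs
    refine ⟨d, L, hT, hdx, ?_, by linarith [abs_nonneg (offset i j x x)]⟩
    rw [he, backStep, if_pos rfl]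
    exact hfb rfl
  · obtain ⟨l, hl, hlt, hle⟩ : ∃ l, i ≠ l ∧ coneCoord l x < coneCoord l s ∧
        (if coneCoord (i + 1) x < coneCoord (i + 1) s then i + 1 else i + 2) = l := by
      have hd := distinct3_cyclic i
      by_cases h : coneCoord (i + 1) x < coneCoord (i + 1) s
      · exact ⟨_, hd.1, h, if_pos h⟩
      · refine ⟨_, hd.2.1, ?_, if_neg h⟩
        have h' := lt_of_le_of_ne (not_lt.1 h) (hP.coneCoord_ne hs.1 hx (Ne.symm hxs) _)
        exact (hs.lt_iff hP hd hxc).1 h'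
    obtain ⟨y, hy⟩ := hxc.exists_succ hs hlt
    obtain ⟨hny, hadj⟩ := hy.next_eq hP hl hv
    have e : advance P t d = (y, .back i s) := by
      rw [he, backStep, if_neg hxs, hle, hny]; rfl
    subst hdx
    have o1 := hy.offset_lt hP hl s
    have o2 := hy.offset_le hP hl s hs
      (by rw [hxc.offset_lt_iff hP hl s hs]; exact hlt)
    rw [offset_self] at o2
    have o3 := hxc.dist_le hP hl s hy.2.1
    have a1 := habs l hl d.1
    have a2 := habs l hl y
    rw [abs_of_neg (by linarith)] at a1
    rw [abs_of_nonpos (by linarith)] at a2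
    rw [abs_of_neg (by linarith)] at o3
    obtain ⟨d', L', h1, h2, h3, h4⟩ := ih y hy.2.1.1 (by linarith) hy.2.1 (y, .back i s)
      (idleStep (nbhd P y) t y (some i)) _ (hT.snoc' e hadj hs.1) rfl rfl
      (by rintro rfl; exact .inr rfl)
    exact ⟨d', L', h1, h2, h3, by simp only at h4; linarith⟩

/-- With `x = C - C'` also `A' - A ≤ x`, so the detour is at most `18x`. Expanding the quadratic
form gives `N'² ≤ N² + x(A - C + x)`, and `N ≥ C + A/2` yields `N' ≤ 19N - 18x`. Here `19 = 2 · 9 +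
1`. -/
lemma detour_aux {A C A' C' N N' : ℝ} (hA : 0 < A) (hC' : 0 < C') (hN0 : 0 ≤ N)
    (hN : N ^ 2 = A ^ 2 + C ^ 2 + A * C) (hN' : N' ^ 2 = A' ^ 2 + C' ^ 2 + A' * C')
    (h1 : A ≤ A') (h2 : C' ≤ C) (h3 : A' + C' ≤ A + C) :
    9 * ((A' - A) + (C - C')) + N' ≤ 19 * N := by
  obtain ⟨x, hx⟩ : ∃ x, x = C - C' := ⟨_, rfl⟩
  have hC : C' = C - x := by linarith
  have hx0 : 0 ≤ x := by linarith
  have e1 : C + A / 2 ≤ N := by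
    refine abs_le_of_sq_le_sq' ?_ hN0 |>.2
    nlinarith
  obtain ⟨e, he⟩ : ∃ e, e = N - x := ⟨_, rfl⟩
  have he2 : A / 2 ≤ e := by linarith
  have hNe : N = x + e := by linarith
  have hN'' : N' ^ 2 ≤ N ^ 2 + x * (A - C + x) := by
    rw [hN', hN, hC]
    nlinarith
  have : N' ≤ 19 * N - 18 * x := by
    refine abs_le_of_sq_le_sq' ?_ (by linarith) |>.2
    refine hN''.trans ?_
    rw [hNe]
    nlinarith [mul_nonneg hx0 (sub_nonneg.2 he2), mul_nonneg hx0 (by linarith : 0 ≤ C - x),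
      sq_nonneg e, mul_nonneg hx0 hA.le]
  linarith

/-- Travelling along the chain to the closest negative neighbour `c` of `v` is cheap. -/
lemma Nearest.detour (hP : GeneralPosition P) {i j : Fin 3} (hij : i ≠ j) {v s c : Plane}
    (hs : s ∈ P) (hsv : Nearest P i s v) (hc : c ∈ P) (hcv : Nearest P i c v)
    (hle : coneCoord i c ≤ coneCoord i s) :
    9 * |offset i j s c| + dist c v ≤ 19 * dist s v ∧
      |offset i j s c| ≤ 2 * (coneCoord i s - coneCoord i v) := by
  have hd := distinct3_third hij
  have s1 := hd.inCone.1 hsv.2.1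
  have s2 := hd.inCone.1 hcv.2.1
  have e1 := hd.sum_eq_zero s
  have e2 := hd.sum_eq_zero c
  have e3 := hd.sum_eq_zero v
  have cs := (onChain_iff_nearest hsv.1).2 ⟨hs, hsv⟩
  have cc := (onChain_iff_nearest hsv.1).2 ⟨hc, hcv⟩
  have q1 := dist_sq_eq hd s v
  have q2 := dist_sq_eq hd c v
  rcases le_or_gt (coneCoord j c) (coneCoord j s) with h | h
  · have h' := (cc.le_iff hP hd cs).1 h
    have ho : |offset i j s c| = ((coneCoord j v - coneCoord j c) - (coneCoord j v - coneCoord j s))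
        + ((coneCoord (third i j) v - coneCoord (third i j) s) -
          (coneCoord (third i j) v - coneCoord (third i j) c)) := by
      rw [abs_of_nonpos (by unfold offset; linarith)]; unfold offset; ring
    rw [ho]
    constructor
    · refine detour_aux ?_ ?_ dist_nonneg q1 q2 ?_ ?_ ?_ <;> linarith
    · linarith
  · have h' := (cs.lt_iff hP hd cc).1 h
    have ho : |offset i j s c| = ((coneCoord (third i j) v - coneCoord (third i j) c) -
          (coneCoord (third i j) v - coneCoord (third i j) s)) +
        ((coneCoord j v - coneCoord j s) - (coneCoord j v - coneCoord j c)) := by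
      rw [abs_of_nonneg (by unfold offset; linarith)]; unfold offset; ring
    rw [ho]
    constructor
    · refine detour_aux (N := dist s v) (N' := dist c v)
        (A := coneCoord (third i j) v - coneCoord (third i j) s)
        (C := coneCoord j v - coneCoord j s) ?_ ?_ dist_nonneg ?_ ?_ ?_ ?_ ?_ <;> linarith
    · linarith

lemma exists_closest_neg {i : Fin 3} {v s : Plane} (hs : s ∈ P) (hsv : Nearest P i s v) :
    ∃ c ∈ P, Nearest P i c v ∧ Kept P i c v ∧
      ∀ y ∈ P, Nearest P i y v → coneCoord i c ≤ coneCoord i y := by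
  classical
  obtain ⟨c, hc, hmin⟩ := (P.filter fun c => Nearest P i c v).exists_min_image (coneCoord i)
    ⟨s, Finset.mem_filter.2 ⟨hs, hsv⟩⟩
  rw [Finset.mem_filter] at hc
  have H : ∀ y ∈ P, Nearest P i y v → coneCoord i c ≤ coneCoord i y := fun y hy hn =>
    hmin y (Finset.mem_filter.2 ⟨hy, hn⟩)
  exact ⟨c, hc.1, hc.2, ⟨hc.1, hc.2, .inr H⟩, H⟩

/-- The closest neighbour `c` is kept. If it lies ahead, the search ends exactly at `c`; if it lies
behind, the next unexplored vertex `a` there is no farther from `s` than `c`, and the doubling bound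
in terms of `a` suffices. -/
lemma SearchInv.cost_le (hP : GeneralPosition P) {i j : Fin 3} {v s x : Plane} {B W : ℝ}
    {o : Option Plane} (hs : OnChain P i v s) (hsv : ¬ Kept P i s v)
    (hB : B = 2 * (coneCoord i s - coneCoord i t)) (hI : SearchInv P i v s B j x o W)
    (hxv : Kept P i x v) (ht : coneCoord i t ≤ coneCoord i v) :
    W + dist x v ≤ 19 * dist s v := by
  have hij := hI.ne
  have hd := distinct3_third hij
  have hvP := hxv.2.1.1
  have os := offset_self i j s
  have hsn := ((onChain_iff_nearest hvP).1 hs).2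
  have hxc := hI.onChain
  have hpos : 0 < offset i j s x := by
    rcases lt_trichotomy (offset i j s x) 0 with h | h | h
    · obtain ⟨h1, h2⟩ := hI.behind x hxv hxc h
      cases o with
      | none => linarith [h2 rfl, hI.bounds.2.2]
      | some a => linarith [h1 a rfl, (hI.other a rfl).2.2.2.2.2]
    · exact absurd (hxc.eq_of_offset_eq hP hij s hs (h.trans os.symm) ▸ hxv) hsv
    · exact h
  obtain ⟨c, hc, hcv, hck, hmin⟩ := exists_closest_neg hs.1 hsn
  have hcc := (onChain_iff_nearest hvP).2 ⟨hc, hcv⟩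
  obtain ⟨d1, d2⟩ := hsn.detour hP hij hs.1 hc hcv (hmin s hs.1 hsn)
  obtain ⟨-, w1⟩ := hI.ahead x hxv hxc hpos
  rcases lt_trichotomy (offset i j s c) 0 with h | h | h
  · obtain ⟨h1, h2⟩ := hI.behind c hck hcc h
    rw [abs_of_neg h] at d1 d2
    cases o with
    | none => linarith [h2 rfl]
    | some a =>
      -- The walk and the way from `x` back to `s` together cost at most `8|a| ≤ 8|c|`, and `9|c| ≤
      -- 19 |sv|`; the remaining `|sv|` fits.
      have := h1 a rfl
      obtain ⟨a1, a2, a3, a4, a5, a6⟩ := hI.other a rfl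
      have t1 := dist_triangle x s v
      have t2 := hxc.dist_le hP hij s hs
      rw [os, sub_zero, abs_of_pos hpos] at t2
      have := dist_nonneg (x := c) (y := v)
      linarith
  · exact absurd (hcc.eq_of_offset_eq hP hij s hs (h.trans os.symm) ▸ hck) hsv
  · have hxle := (hI.ahead c hck hcc h).1
    rw [abs_of_pos h] at d1
    rcases hxle.lt_or_eq with hlt | heq
    -- A kept vertex strictly between `s` and `c` is neither extreme, having chain vertices on both
    -- sides, nor closest.
    · exfalso
      rw [hxc.offset_lt_iff hP hij s hcc] at hlt
      have hsx := (hs.offset_lt_iff hP hij s hxc).1 (by rw [os]; exact hpos)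
      rcases hxv.2.2 with ⟨l, hl, hext⟩ | hcl
      · refine (hd.forall_ne (Q := fun l => ¬ ∀ y ∈ P, Nearest P i y v →
          coneCoord l y ≤ coneCoord l x)).2 ⟨fun H => ?_, fun H => ?_⟩ l hl hext
        · exact (H c hc hcv).not_gt hlt
        · exact (H s hs.1 hsn).not_gt ((hs.lt_iff hP hd hxc).1 hsx)
      · exact hP.coneCoord_ne hxc.1 hc (by rintro rfl; exact lt_irrefl _ hlt) i
          (le_antisymm (hcl c hc hcv) (hmin x hxc.1 hxv.2.1))
    · obtain rfl := hxc.eq_of_offset_eq hP hij s hcc heq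
      linarith

lemma searchStep_of_kept (hP : GeneralPosition P) {i j : Fin 3} {v x s : Plane}
    {f : Option (Fin 3)} {o : Option Plane} {fb : Plane × RState} (h : Kept P i x v) :
    searchStep fb (nbhd P x) t x i j f s o = if coneCoord i t ≤ coneCoord i v then
      (v, .idle (newFlag i f s t v)) else backStep fb (nbhd P x) i s x := by
  have hm := hP.mem_nbhd_inCone.2 h
  have h' : ∃ y ∈ nbhd P x, InCone i x y := ⟨v, hm⟩
  have e : h'.choose = v :=
    (hP.mem_nbhd_inCone.1 h'.choose_spec).2.1.unique hP h.2.1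
  rw [searchStep, dif_pos h', e]

lemma Kept.adj (hP : GeneralPosition P) {i : Fin 3} {x v : Plane} (h : Kept P i x v) :
    (GTwelve P).Adj x v := hP.gTwelve_adj_iff.2 ⟨i, .inl h⟩

/-- The result of a search from `s`: it reaches the nearest vertex in the cone `C_i` of `s`, if this
vertex is not beyond `t`, and otherwise it returns to `s`. -/
lemma search_result (hP : GeneralPosition P) {i : Fin 3} {s : Plane} {f : Option (Fin 3)}
    {c fb : Plane × RState} (hs : s ∈ P) (hts : coneCoord i t < coneCoord i s) (hc : c.1 = s)
    (hcp : c.2.PointsIn P) (he : advance P t c = startSearch fb (nbhd P s) t s i f) :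
    (∀ y, Nearest P i s y → coneCoord i t ≤ coneCoord i y →
      ∃ L, Trip P t c (y, .idle (newFlag i f s t y)) L ∧ L ≤ 19 * dist s y) ∧
    ((∀ y, Nearest P i s y → coneCoord i y < coneCoord i t) →
      ∃ d L, Trip P t c d L ∧ d.1 = s ∧
        (advance P t d = fb ∨ advance P t d = idleStep (nbhd P s) t s (some i)) ∧
        L ≤ 20 * (coneCoord i s - coneCoord i t)) := by
  have hd := distinct3_cyclic i
  obtain ⟨B, hB⟩ : ∃ B, B = 2 * (coneCoord i s - coneCoord i t) := ⟨_, rfl⟩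
  have hBpos : 0 < B := by linarith
  have h0 : Trip P t c c 0 := .refl (hc ▸ hs) hcp
  obtain ⟨v, hv, hsc⟩ : ∃ v, Anchor P i v ∧ OnChain P i v s := by
    by_cases h : ∃ w ∈ P, InCone i s w
    · obtain ⟨w, hw, hsw⟩ := h
      obtain ⟨v, hv⟩ := exists_nearest hw hsw
      exact ⟨v, .inl hv.1, (onChain_iff_nearest hv.1).2 ⟨hs, hv⟩⟩
    · push Not at h
      obtain ⟨v, hv⟩ := exists_virtual_anchor P i
      exact ⟨v, .inr hv, hs, (hv s hs).1, fun w hw hsw => absurd hsw (h w hw)⟩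
  have hnear : ∀ y, Nearest P i s y → y = v ∧ v ∈ P := by
    intro y hy
    rcases hv with hv | hv
    · exact ⟨hy.unique hP ((onChain_iff_nearest hv).1 hsc).2, hv⟩
    · exact absurd (hsc.2.2 y hy.1 hy.2.1) (hv y hy.1).2.not_ge
  by_cases hsv : Kept P i s v
  · rw [startSearch, searchStep_of_kept hP hsv] at he
    constructor
    · intro y hy hty
      obtain ⟨rfl, -⟩ := hnear y hy
      rw [if_pos hty] at he
      refine ⟨_, h0.snoc' he (by rw [hc]; exact hsv.adj hP) trivial, ?_⟩
      have := dist_nonneg (x := s) (y := y)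
      rw [hc]; simp only; linarith
    · intro hy
      rw [if_neg (hy v hsv.2.1).not_ge, backStep, if_pos rfl] at he
      exact ⟨c, 0, h0, hc, .inl he, by linarith⟩
  · have hat : SearchAt P t i v s B f fb c c 0 fb (i + 1)
        (boundedNext (nbhd P s) i (i + 2) s B s) := by
      refine ⟨⟨0, h0, le_rfl⟩, ?_, fun _ => .inl rfl, ?_⟩
      · rw [hc, he, startSearch, hB]
      · rw [hc]
        have hoff : ∀ z, offset i (i + 2) s z = - offset i (i + 1) s z := fun z => by
          rw [← offset_third, hd.third_eq]
        have os := offset_self i (i + 1) s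
        have hb := boundedNext_cases hP hd.2.1 hv s B hsc hsv
        generalize boundedNext (nbhd P s) i (i + 2) s B s = nx at hb
        constructor
        · exact hd.1
        · exact hsc
        · intro z _ _ hz
          rw [os]; constructor <;> linarith
        · intro z hz hzc hneg
          rcases hb with ⟨x', h1, h2, rfl⟩ | ⟨rfl, h2⟩
          · refine ⟨fun a ha => ?_, fun h => by simp at h⟩
            obtain rfl : x' = a := by simpa using ha
            have := h1.offset_le hP hd.2.1 s hzc (by rw [hoff, hoff, os]; linarith)
            rw [hoff, hoff] at this
            linarith
          · refine ⟨fun a ha => by simp at ha, fun _ => ?_⟩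
            have := h2 z hzc (by rw [hoff, hoff, os]; linarith)
            rw [hoff] at this
            linarith
        · intro a ha
          rcases hb with ⟨x', h1, h2, rfl⟩ | ⟨rfl, h2⟩
          · obtain rfl : x' = a := by simpa using ha
            have := h1.offset_lt hP hd.2.1 s
            rw [hoff, hoff, os] at this
            rw [hoff] at h2
            rw [os]
            refine ⟨h1.2.1, ?_, ?_, ?_, ?_, ?_⟩ <;> linarith
          · simp at ha
        · rw [os]
          refine ⟨?_, ?_, ?_⟩ <;> linarith
    obtain ⟨d, W, fb', j, o, ⟨⟨L, hT, hL⟩, hstep, hfb, hI⟩, hend⟩ :=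
      hat.exists_end hP hv hsc hsv hBpos hB le_rfl
    obtain ⟨b1, b2, b3⟩ := hI.bounds
    have hback : advance P t d = backStep fb' (nbhd P d.1) i s d.1 →
        ∃ d L, Trip P t c d L ∧ d.1 = s ∧
        (advance P t d = fb ∨ advance P t d = idleStep (nbhd P s) t s (some i)) ∧
        L ≤ 20 * (coneCoord i s - coneCoord i t) := by
      intro hb
      obtain ⟨d', L', h1, h2, h3, h4⟩ := Trip.back (j := j) hP hI.ne hv hsc d.1 hI.onChain.1
        hI.onChain d fb' L hT rfl hb hfb
      refine ⟨d', L', h1, h2, h3, h4.trans ?_⟩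
      -- At most `9B` for the search and `B` for the return, with `B` twice the height above `t`.
      rcases abs_cases (offset i j s d.1) with ⟨h, -⟩ | ⟨h, -⟩ <;> rw [h] <;> linarith
    constructor
    · intro y hy hty
      obtain ⟨rfl, -⟩ := hnear y hy
      rcases hend with hk | ⟨-, hnone⟩
      · rw [searchStep_of_kept hP hk, if_pos hty] at hstep
        refine ⟨_, hT.snoc' hstep (hk.adj hP) trivial, ?_⟩
        have := hI.cost_le hP hsc hsv hB hk hty
        simp only
        linarith
      · exfalso
        -- The closest neighbour is kept and has offset at most `B`, so an empty-handed search
        -- contradicts a target not beyond `t`.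
        obtain ⟨z, hz, hzn, hzk, hmin⟩ := exists_closest_neg hs hy
        have h1 := hnone z hzk ((onChain_iff_nearest hy.1).2 ⟨hz, hzn⟩)
        have h2 := (hy.detour hP hI.ne hs hz hzn (hmin s hs hy)).2
        linarith
    · intro hy
      refine hback ?_
      rcases hend with hk | ⟨hb, -⟩
      · have hsn := ((onChain_iff_nearest hk.2.1.1).1 hsc).2
        rw [hstep, searchStep_of_kept hP hk, if_neg (hy v hsn).not_ge]
      · exact hb

end

/-! ### Moving to a negative neighbour in the triangle at `t`. -/

noncomputable section

variable {P : Finset Plane} {t : Plane}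

lemma kept_iff_mem_nbhd (hP : GeneralPosition P) {i : Fin 3} {s : Plane} {Q : Plane → Prop} :
    (∃ z ∈ nbhd P s, InCone i z s ∧ Q z) ↔ ∃ z, Kept P i z s ∧ Q z := by
  refine exists_congr fun z => ?_
  rw [← and_assoc, hP.mem_nbhd_inCone_swap]

lemma exists_extreme_neg {i j : Fin 3} (hij : i ≠ j) {v s : Plane} (hs : s ∈ P)
    (hsv : Nearest P i s v) :
    ∃ c, Kept P i c v ∧ ∀ y ∈ P, Nearest P i y v → coneCoord j y ≤ coneCoord j c := by
  classical
  obtain ⟨c, hc, hmax⟩ := (P.filter fun c => Nearest P i c v).exists_max_image (coneCoord j)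
    ⟨s, Finset.mem_filter.2 ⟨hs, hsv⟩⟩
  rw [Finset.mem_filter] at hc
  have H : ∀ y ∈ P, Nearest P i y v → coneCoord j y ≤ coneCoord j c := fun y hy hn =>
    hmax y (Finset.mem_filter.2 ⟨hy, hn⟩)
  exact ⟨c, ⟨hc.1, hc.2, .inl ⟨j, hij.symm, H⟩⟩, H⟩

/-- The walk along the chain of `s` ends at the first chain vertex `m` on the near side of `t`. -/
lemma Trip.walk (hP : GeneralPosition P) {i j : Fin 3} (hij : i ≠ j) {s m z₀ : Plane}
    {c : Plane × RState} {f : Option (Fin 3)} (hs : s ∈ P) (hm : OnChain P i s m)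
    (htm : coneCoord j t ≤ coneCoord j m)
    (hmin : ∀ z, OnChain P i s z → coneCoord j t ≤ coneCoord j z → coneCoord j m ≤ coneCoord j z)
    (hz₀ : OnChain P i s z₀) (hz₀t : coneCoord j z₀ < coneCoord j t) :
    ∀ x ∈ P, OnChain P i s x → ∀ (d : Plane × RState) (L : ℝ), Trip P t c d L → d.1 = x →
      advance P t d = walkStep (nbhd P x) t x i j f →
      ∃ d' L', Trip P t c d' L' ∧ d'.1 = m ∧ advance P t d' = idleStep (nbhd P m) t m f ∧
        L' ≤ L + |offset i j m x| := by
  have hd := distinct3_third hij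
  have hik := hd.2.1
  have hv : Anchor P i s := .inl hs
  refine finset_induction_real P (fun x => |offset i j m x|) _ ?_
  intro x hx ih hxc d L hT hdx he
  have om := offset_self i j m
  have go : ∀ y, (GTwelve P).Adj x y → OnChain P i s y →
      |offset i j m y| + |offset i j m x - offset i j m y| ≤ |offset i j m x| →
      advance P t d = (y, .walk i j f) →
      ∃ d' L', Trip P t c d' L' ∧ d'.1 = m ∧ advance P t d' = idleStep (nbhd P m) t m f ∧
        L' ≤ L + |offset i j m x| := by
    intro y hadj hyc hle e
    subst hdx
    have h1 := hxc.dist_le hP hij m hyc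
    have h2 := dist_pos.2 hadj.ne
    obtain ⟨d', L', g1, g2, g3, g4⟩ := ih y hyc.1 (by linarith) hyc (y, .walk i j f) _
      (hT.snoc' e hadj trivial) rfl rfl
    exact ⟨d', L', g1, g2, g3, by simp only at g4; linarith⟩
  rw [walkStep] at he
  by_cases hxt : coneCoord j x < coneCoord j t
  · obtain ⟨y, hy⟩ := hxc.exists_succ hm (hxt.trans_le htm)
    obtain ⟨hny, hadj⟩ := hy.next_eq hP hij hv
    rw [if_pos hxt, hny] at he
    refine go y hadj hy.2.1 ?_ he
    have o1 := hy.offset_lt hP hij m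
    have o2 := hy.offset_le hP hij m hm
      ((hxc.offset_lt_iff hP hij m hm).2 (hxt.trans_le htm))
    rw [om] at o2
    rw [abs_of_nonpos (by linarith), abs_of_neg (by linarith), abs_of_neg (by linarith)]
    linarith
  · rw [if_neg hxt] at he
    have hmx := hmin x hxc (not_lt.1 hxt)
    by_cases hxm : x = m
    · subst hxm
      obtain ⟨y, hy⟩ := hxc.exists_succ (j := third i j) hz₀
        ((hz₀.lt_iff hP hd hxc).1 (hz₀t.trans_le htm))
      obtain ⟨hny, hadj⟩ := hy.next_eq hP hik hv
      have hlt := (hy.swap hP hd.swap).2.2.1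
      rw [hny, if_neg] at he
      · exact ⟨d, L, hT, hdx, he, by linarith [abs_nonneg (offset i j x x)]⟩
      · rintro ⟨z, hz, hle⟩
        obtain rfl : y = z := by simpa using hz
        exact (hmin y hy.2.1 hle).not_gt hlt
    · have hlt := lt_of_le_of_ne hmx (hP.coneCoord_ne hm.1 hx (Ne.symm hxm) j)
      obtain ⟨y, hy⟩ := hxc.exists_succ hm ((hm.lt_iff hP hd hxc).1 hlt)
      obtain ⟨hny, hadj⟩ := hy.next_eq hP hik hv
      have o1 := hy.offset_lt hP hik m
      have o2 := hy.offset_le hP hik m hm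
        ((hxc.offset_lt_iff hP hik m hm).2 ((hm.lt_iff hP hd hxc).1 hlt))
      rw [offset_third, offset_third] at o1 o2
      rw [om] at o2
      have hmy : coneCoord j m ≤ coneCoord j y := by
        rw [← not_lt, ← hy.2.1.offset_lt_iff hP hij m hm, om]; linarith
      rw [hny, if_pos ⟨y, rfl, htm.trans hmy⟩] at he
      refine go y hadj hy.2.1 ?_ he
      rw [abs_of_nonneg (by linarith), abs_of_pos (by linarith), abs_of_pos (by linarith)]
      linarith

/-- Either there is no neighbour of `s` above `t`, or the routing reaches the extreme one. -/
lemma descend_cases (hP : GeneralPosition P) {i j : Fin 3} (hij : i ≠ j) {s : Plane}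
    (hs : s ∈ P) (ht : t ∈ P) (hts : InCone i t s) (f : Option (Fin 3)) :
    (descend (nbhd P s) t s i j f = none ∧ ∀ m ∈ P, Nearest P i m s →
      coneCoord j t ≤ coneCoord j m → ¬ coneCoord (third i j) t ≤ coneCoord (third i j) m) ∨
    ∃ m ∈ P, Nearest P i m s ∧ coneCoord j t ≤ coneCoord j m ∧
      coneCoord (third i j) t ≤ coneCoord (third i j) m ∧
      (∀ z ∈ P, Nearest P i z s → coneCoord j t ≤ coneCoord j z → coneCoord j m ≤ coneCoord j z) ∧
      ∃ r, descend (nbhd P s) t s i j f = some r ∧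
        ∀ c : Plane × RState, c.1 = s → c.2.PointsIn P → advance P t c = r →
          ∃ d L, Trip P t c d L ∧ d.1 = m ∧ advance P t d = idleStep (nbhd P m) t m f ∧
            L ≤ 19 * dist s m := by
  have hd := distinct3_third hij
  have chain : ∀ z, z ∈ P → Nearest P i z s → OnChain P i s z := fun z hz hn =>
    (onChain_iff_nearest hs).2 ⟨hz, hn⟩
  rw [descend]
  split_ifs with hA hB
  · right
    obtain ⟨h1, h2, h3, h4, h5⟩ := hA.choose_spec
    generalize hA.choose = y at *
    have hk := hP.mem_nbhd_inCone_swap.1 ⟨h1, h2⟩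
    refine ⟨y, hk.1, hk.2.1, h4, h5, fun z hz hn _ => ?_, _, rfl, fun c hc hcp he => ?_⟩
    · obtain ⟨w, hw, hmax⟩ := exists_extreme_neg hd.2.1 hz hn
      obtain ⟨w1, w2⟩ := hP.mem_nbhd_inCone_swap.2 hw
      exact ((chain y hk.1 hk.2.1).le_iff hP hd (chain z hz hn)).2
        ((hmax z hz hn).trans (h3 w w1 w2))
    · have h0 : Trip P t c c 0 := .refl (hc ▸ hs) hcp
      refine ⟨_, _, h0.snoc' he (by rw [hc]; exact (hk.adj hP).symm) trivial, rfl, rfl, ?_⟩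
      rw [hc]
      have := dist_nonneg (x := s) (y := y)
      simp only; linarith
  · right
    have hz₀ := (kept_iff_mem_nbhd hP).1 hB.choose_spec.2.2.2.1
    have hz₁ := (kept_iff_mem_nbhd hP).1 hB.choose_spec.2.2.2.2
    obtain ⟨h1, h2, h3, -, -⟩ := hB.choose_spec
    generalize hB.choose = c at *
    obtain ⟨z₀, hz₀, hz₀t⟩ := hz₀
    obtain ⟨z₁, hz₁, hz₁t⟩ := hz₁
    have hck := hP.mem_nbhd_inCone_swap.1 ⟨h1, h2⟩
    have cz₀ := chain z₀ hz₀.1 hz₀.2.1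
    classical
    obtain ⟨m, hm, hmin⟩ := (P.filter fun m => Nearest P i m s ∧
      coneCoord j t ≤ coneCoord j m).exists_min_image (coneCoord j)
      ⟨z₁, Finset.mem_filter.2 ⟨hz₁.1, hz₁.2.1, hz₁t⟩⟩
    rw [Finset.mem_filter] at hm
    have cm := chain m hm.1 hm.2.1
    have hmin' : ∀ z ∈ P, Nearest P i z s → coneCoord j t ≤ coneCoord j z →
        coneCoord j m ≤ coneCoord j z := fun z hz hn hle =>
      hmin z (Finset.mem_filter.2 ⟨hz, hn, hle⟩)
    refine ⟨m, hm.1, hm.2.1, hm.2.2, ?_, hmin', _, rfl, fun b hb hbp he => ?_⟩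
    -- Otherwise `t` would lie in the gap between `m` and its chain neighbour beyond `t`, above the
    -- level of `s`.
    · by_contra hlt
      obtain ⟨x, hx⟩ := cm.exists_succ (j := third i j) cz₀
        ((cz₀.lt_iff hP hd cm).1 (hz₀t.trans_le hm.2.2))
      have hx' := hx.swap hP hd.swap
      have hxt : coneCoord j x < coneCoord j t := by
        by_contra hc
        exact (hmin' x hx.2.1.1 ((onChain_iff_nearest hs).1 hx.2.1).2 (not_lt.1 hc)).not_gt hx'.2.2.1
      exact (hx'.gap_empty hP hd ht hxt (not_le.1 hlt)).not_gt hts.lt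
    · have h0 : Trip P t b b 0 := .refl (hb ▸ hs) hbp
      obtain ⟨d, L, g1, g2, g3, g4⟩ := Trip.walk (f := f) hP hij hs cm hm.2.2
        (fun z hz hle => hmin' z hz.1 ((onChain_iff_nearest hs).1 hz).2 hle) cz₀ hz₀t c hck.1
        (chain c hck.1 hck.2.1) _ _
        (h0.snoc' he (by rw [hb]; exact (hck.adj hP).symm) trivial) rfl rfl
      refine ⟨d, L, g1, g2, g3, g4.trans ?_⟩
      -- `c` is minimal only among visible neighbours, but the true closest neighbour is visible.
      have hcl : coneCoord i c ≤ coneCoord i m := by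
        obtain ⟨w, -, -, hw, hmw⟩ := exists_closest_neg hm.1 hm.2.1
        obtain ⟨w1, w2⟩ := hP.mem_nbhd_inCone_swap.2 hw
        exact (h3 w w1 w2).trans (hmw m hm.1 hm.2.1)
      have := (hm.2.1.detour hP hij hm.1 hck.1 hck.2.1 hcl).1
      rw [hb, dist_comm s c, dist_comm s m]
      have := abs_nonneg (offset i j m c)
      linarith
  · left
    refine ⟨rfl, fun m hm hn hj hk => ?_⟩
    -- If a suitable `m` exists and the extreme `w` is unsuitable, then `w` is beyond `t` in
    -- coordinate `j` while the opposite extreme is not. This enables the walk, contrary to the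
    -- failed test.
    obtain ⟨w, hw, hmax⟩ := exists_extreme_neg hd.2.1 hm hn
    obtain ⟨w1, w2⟩ := hP.mem_nbhd_inCone_swap.2 hw
    have hwk := hk.trans (hmax m hm hn)
    have hwt : coneCoord j w < coneCoord j t := by
      by_contra hc
      refine hA ⟨w, w1, w2, fun z hz hzs => ?_, not_lt.1 hc, hwk⟩
      have := hP.mem_nbhd_inCone_swap.1 ⟨hz, hzs⟩
      exact hmax z this.1 this.2.1
    obtain ⟨e, he, hemax⟩ := exists_extreme_neg hij hm hn
    obtain ⟨c, -, -, hc, hcl⟩ := exists_closest_neg hm hn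
    obtain ⟨c1, c2⟩ := hP.mem_nbhd_inCone_swap.2 hc
    refine hB ⟨c, c1, c2, fun z hz hzs => ?_, (kept_iff_mem_nbhd hP).2 ⟨w, hw, hwt⟩,
      (kept_iff_mem_nbhd hP).2 ⟨e, he, hj.trans (hemax m hm hn)⟩⟩
    have := hP.mem_nbhd_inCone_swap.1 ⟨hz, hzs⟩
    exact hcl z this.1 this.2.1

/-! ### Empty side regions. -/

/-- The side region of `s` in direction `j`, on the way to `t`, contains no vertex. -/
def SideEmpty (P : Finset Plane) (t : Plane) (j : Fin 3) (s : Plane) : Prop :=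
  ∀ p ∈ P, InCone j s p → coneCoord j p < coneCoord j t

section Invariants
variable {i j k : Fin 3} {s m y : Plane}

/-- A vertex in the side region of `m` would generate a chain vertex of `s` that still satisfies the
condition at `t` but precedes `m` in coordinate `j`. This is why the extreme neighbour away from the
empty side is chosen. -/
lemma SideEmpty.of_descend (hP : GeneralPosition P) (hd : Distinct3 i j k) (hs : s ∈ P)
    (hE : SideEmpty P t j s) (hm : m ∈ P) (hms : Nearest P i m s)
    (hmin : ∀ z ∈ P, Nearest P i z s → coneCoord j t ≤ coneCoord j z →
      coneCoord j m ≤ coneCoord j z) : SideEmpty P t j m := by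
  have hj := hd.rotate
  have cm := hd.inCone.1 hms.2.1
  have lm := hms.2.1.lt
  intro p hp hmp
  by_contra hpt
  rw [not_lt] at hpt
  have cp := hj.inCone.1 hmp
  have lp := hmp.lt
  have small : ∀ q ∈ P, coneCoord j t ≤ coneCoord j q → coneCoord i s < coneCoord i q →
      coneCoord k q ≤ coneCoord k s := by
    intro q hq h1 h2
    by_contra hc
    exact (hE q hq (hj.inCone.2 ⟨not_le.1 hc, h2⟩)).not_ge h1
  obtain ⟨q, hqR, hq⟩ := exists_onChain_of_region (i := i) (v := s) (z := p) (R := fun q =>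
      coneCoord j t ≤ coneCoord j q ∧ coneCoord j q < coneCoord j m ∧
      coneCoord k m < coneCoord k q ∧ coneCoord i s < coneCoord i q) hp
    ⟨hpt, lp, cp.1, by linarith⟩
    (fun q hq hR => by
      have h1 := small q hq hR.1 hR.2.2.2
      have h2 : q ≠ s := by rintro rfl; exact lt_irrefl _ hR.2.2.2
      have := lt_of_le_of_ne h1 (hP.coneCoord_ne hq hs h2 k)
      exact hd.inCone.2 ⟨by linarith, this⟩)
    (fun q hq hR w hw hqw hsw => by
      have cw := hd.inCone.1 hqw
      refine ⟨by linarith, ?_, by linarith, hsw⟩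
      by_contra hc
      have hne : m ≠ w := by rintro rfl; linarith
      have := lt_of_le_of_ne (not_lt.1 hc) (hP.coneCoord_ne hm hw hne j)
      exact (hms.2.2 w hw (hd.inCone.2 ⟨this, by linarith⟩)).not_gt hsw)
  have := hmin q hq.1 ((onChain_iff_nearest hs).1 hq).2 hqR.1
  linarith [hqR.2.1]

/-- A vertex in the side region of `y` would generate a chain vertex of `s` inside the triangle at
`t`; the empty side and the choice of `y` as nearest confine the region to the negative cone of `s`.
-/
lemma SideEmpty.of_side (hP : GeneralPosition P) (hd : Distinct3 i j k) (hs : s ∈ P)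
    (hE : SideEmpty P t j s) (hys : Nearest P k s y) (hty : coneCoord k t ≤ coneCoord k y)
    (hno : ∀ m ∈ P, Nearest P i m s → coneCoord j t ≤ coneCoord j m →
      ¬ coneCoord k t ≤ coneCoord k m) : SideEmpty P t j y := by
  have hj := hd.rotate
  have hk := hd.rotate.rotate
  have cy := hk.inCone.1 hys.2.1
  intro p hp hyp
  by_contra hpt
  rw [not_lt] at hpt
  have cp := hj.inCone.1 hyp
  obtain ⟨q, hqR, hq⟩ := exists_onChain_of_region (i := i) (v := s) (z := p) (R := fun q =>
      coneCoord j t ≤ coneCoord j q ∧ coneCoord k y < coneCoord k q ∧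
      coneCoord i s < coneCoord i q) hp ⟨hpt, cp.1, by linarith⟩
    (fun q hq hR => by
      have hne : q ≠ s := by rintro rfl; exact lt_irrefl _ hR.2.2
      have h1 : coneCoord k q ≤ coneCoord k s := by
        by_contra hc
        exact (hE q hq (hj.inCone.2 ⟨not_le.1 hc, hR.2.2⟩)).not_ge hR.1
      have h2 : coneCoord j q ≤ coneCoord j s := by
        by_contra hc
        exact (hys.2.2 q hq (hk.inCone.2 ⟨hR.2.2, not_le.1 hc⟩)).not_gt hR.2.1
      exact hd.inCone.2 ⟨lt_of_le_of_ne h2 (hP.coneCoord_ne hq hs hne j),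
        lt_of_le_of_ne h1 (hP.coneCoord_ne hq hs hne k)⟩)
    (fun q hq hR w hw hqw hsw => by
      have cw := hd.inCone.1 hqw
      exact ⟨by linarith, by linarith, hsw⟩)
  exact hno q hq.1 ((onChain_iff_nearest hs).1 hq).2 hqR.1 (by linarith [hqR.2.1])

/-- If the second side were empty too, the chain argument started at `t` itself would yield a
neighbour of `s` in the triangle. Hence a search on the second side succeeds. -/
lemma exists_side_vertex (hP : GeneralPosition P) (hd : Distinct3 i j k) (hs : s ∈ P) (ht : t ∈ P)
    (hts : InCone i t s) (hE : SideEmpty P t j s)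
    (hno : ∀ m ∈ P, Nearest P i m s → coneCoord j t ≤ coneCoord j m →
      ¬ coneCoord k t ≤ coneCoord k m) : ∃ y, Nearest P k s y ∧ coneCoord k t ≤ coneCoord k y := by
  by_contra! hc
  have hj := hd.rotate
  have hk := hd.rotate.rotate
  have hE' : SideEmpty P t k s := by
    intro p hp hsp
    obtain ⟨y, hy⟩ := exists_nearest hp hsp
    exact (hy.2.2 p hp hsp).trans_lt (hc y hy)
  obtain ⟨q, hqR, hq⟩ := exists_onChain_of_region (i := i) (v := s) (z := t) (R := fun q =>
      coneCoord j t ≤ coneCoord j q ∧ coneCoord k t ≤ coneCoord k q ∧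
      coneCoord i s < coneCoord i q) ht ⟨le_rfl, le_rfl, hts.lt⟩
    (fun q hq hR => by
      have hne : q ≠ s := by rintro rfl; exact lt_irrefl _ hR.2.2
      have h1 : coneCoord k q ≤ coneCoord k s := by
        by_contra hc
        exact (hE q hq (hj.inCone.2 ⟨not_le.1 hc, hR.2.2⟩)).not_ge hR.1
      have h2 : coneCoord j q ≤ coneCoord j s := by
        by_contra hc
        exact (hE' q hq (hk.inCone.2 ⟨hR.2.2, not_le.1 hc⟩)).not_ge hR.2.1
      exact hd.inCone.2 ⟨lt_of_le_of_ne h2 (hP.coneCoord_ne hq hs hne j),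
        lt_of_le_of_ne h1 (hP.coneCoord_ne hq hs hne k)⟩)
    (fun q hq hR w hw hqw hsw => by
      have cw := hd.inCone.1 hqw
      exact ⟨by linarith, by linarith, hsw⟩)
  exact hno q hq.1 ((onChain_iff_nearest hs).1 hq).2 hqR.1 hqR.2.1

end Invariants

/-! ### Potentials for the routing. -/

lemma idleStep_of_inCone {N : Set Plane} {i : Fin 3} {s : Plane} {f : Option (Fin 3)}
    (h : InCone i s t) : idleStep N t s f = startSearch (s, .idle none) N t s i none := by
  have h' : ∃ i, InCone i s t := ⟨i, h⟩
  rw [idleStep, dif_pos h', h'.choose_spec.index_unique h]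

lemma idleStep_some_of_inCone_swap {N : Set Plane} {i j : Fin 3} {s : Plane}
    (h : InCone i t s) : idleStep N t s (some j) = flagStep N t s i j := by
  have h' : ∃ i, InCone i t s := ⟨i, h⟩
  have h'' : ¬ ∃ i, InCone i s t := fun ⟨_, hi⟩ => h.not_inCone_swap hi
  simp only [idleStep, dif_neg h'', dif_pos h', h'.choose_spec.index_unique h]

lemma idleStep_none_of_inCone_swap {N : Set Plane} {i : Fin 3} {s : Plane} (h : InCone i t s) :
    idleStep N t s none = (descend N t s i (smallSide i t s) none).getD
      (startSearch (flagStep N t s i (smallSide i t s)) N t s (smallSide i t s) none) := by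
  have h' : ∃ i, InCone i t s := ⟨i, h⟩
  have h'' : ¬ ∃ i, InCone i s t := fun ⟨_, hi⟩ => h.not_inCone_swap hi
  simp only [idleStep, dif_neg h'', dif_pos h', h'.choose_spec.index_unique h]

lemma InCone.dist_le {i : Fin 3} {u v : Plane} (h : InCone i u v) :
    dist u v ≤ coneCoord i u - coneCoord i v := by
  obtain ⟨j, k, hd⟩ := Distinct3.exists_of i
  have := hd.inCone.1 h
  have h1 := dist_le_add hd u v
  rw [abs_of_pos (by linarith), abs_of_pos (by linarith)] at h1
  have := hd.sum_eq_zero u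
  have := hd.sum_eq_zero v
  linarith

lemma arrives_of_eq {c : Plane × RState} {L : ℝ} (hc : c.1 ∈ P) (hp : c.2.PointsIn P)
    (h : c.1 = t) (hL : 0 ≤ L) : Arrives P t c L := ⟨c, 0, .refl hc hp, h, hL⟩

/-- A vertex of the triangle at `t` is `t` or lies strictly inside the cone of `t`. -/
lemma GeneralPosition.eq_or_inCone (hP : GeneralPosition P) {i j k : Fin 3} (hd : Distinct3 i j k)
    {m : Plane} (ht : t ∈ P) (hm : m ∈ P) (h1 : coneCoord j t ≤ coneCoord j m)
    (h2 : coneCoord k t ≤ coneCoord k m) : m = t ∨ InCone i t m := by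
  refine or_iff_not_imp_left.2 fun hne => hd.inCone.2 ⟨?_, ?_⟩
  · exact lt_of_le_of_ne h1 (hP.coneCoord_ne ht hm (Ne.symm hne) j)
  · exact lt_of_le_of_ne h2 (hP.coneCoord_ne ht hm (Ne.symm hne) k)

/-- The potential is the height plus the extent of the side not known to be empty. A descent to `m`
lowers the height by at least its length, a side step lowers the extent by at least its length, and
neither raises the other term. -/
lemma arrives_flag (hP : GeneralPosition P) (ht : t ∈ P) {i j k : Fin 3} (hd : Distinct3 i j k) :
    ∀ s ∈ P, InCone i t s → SideEmpty P t j s →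
      Arrives P t (s, .idle (some j))
        (19 * ((coneCoord i t - coneCoord i s) + (coneCoord k s - coneCoord k t))) := by
  have hk3 := hd.third_eq
  have hk := hd.rotate.rotate
  refine finset_induction_real P (fun s => - coneCoord i s) _ ?_
  intro s hs ih hts hE
  have hadv : advance P t (s, .idle (some j)) = flagStep (nbhd P s) t s i j :=
    idleStep_some_of_inCone_swap hts
  have cts := hd.inCone.1 hts
  have lts := hts.lt
  rcases descend_cases hP hd.1 hs ht hts (some j) with ⟨hnone, hno⟩ |
    ⟨m, hm, hms, hmj, hmk, hmin, r, hr, htrip⟩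
  · rw [hk3] at hno
    obtain ⟨y, hy, hty⟩ := exists_side_vertex hP hd hs ht hts hE hno
    rw [flagStep, hnone, Option.getD_none, hk3] at hadv
    have cy := hk.inCone.1 hy.2.1
    obtain ⟨L, hT, hL⟩ := (search_result (c := (s, .idle (some j))) hP hs cts.2 rfl trivial hadv).1 y hy hty
    rw [newFlag, if_neg hts.not_inCone_swap] at hT
    have hyt : InCone i t y := (hP.eq_or_inCone hd ht hy.1 (by linarith) hty).resolve_left
      (by rintro rfl; linarith)
    have := ih y hy.1 (by linarith) hyt (hE.of_side hP hd hs hy hty hno)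
    refine (hT.arrives rfl rfl this).mono ?_
    have := hy.2.1.dist_le
    linarith
  · rw [hk3] at hmk
    rw [flagStep, hr, Option.getD_some] at hadv
    obtain ⟨d, L, hT, hdm, hdadv, hL⟩ := htrip (s, .idle (some j)) rfl trivial hadv
    have hA : Arrives P t (m, .idle (some j))
        (19 * ((coneCoord i t - coneCoord i m) + (coneCoord k m - coneCoord k t))) := by
      rcases hP.eq_or_inCone hd ht hm hmj hmk with rfl | htm
      · exact arrives_of_eq hm trivial rfl (by simp)
      · exact ih m hm (neg_lt_neg hms.2.1.lt) htm (hE.of_descend hP hd hs hm hms hmin)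
    refine (hT.arrives (e := (m, .idle (some j))) hdm hdadv hA).mono ?_
    have h1 := hms.2.1.dist_le
    have h2 := (hd.inCone.1 hms.2.1).2
    rw [dist_comm] at h1
    linarith

lemma smallSide_spec (i : Fin 3) (t s : Plane) : ∃ k, Distinct3 i (smallSide i t s) k ∧
    coneCoord (smallSide i t s) s - coneCoord (smallSide i t s) t ≤ coneCoord k s - coneCoord k t ∧
    ∀ x, min (coneCoord (i + 1) x - coneCoord (i + 1) t) (coneCoord (i + 2) x - coneCoord (i + 2) t)
      = min (coneCoord (smallSide i t s) x - coneCoord (smallSide i t s) t)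
        (coneCoord k x - coneCoord k t) := by
  have hd := distinct3_cyclic i
  unfold smallSide
  split_ifs with h
  · exact ⟨_, hd, h, fun x => rfl⟩
  · exact ⟨_, hd.swap, (not_le.1 h).le, fun x => min_comm _ _⟩

/-- The height counts twice, to leave room for one failed search and for the larger side afterwards;
the minimum pays for steps into the smaller side. -/
lemma arrives_neg (hP : GeneralPosition P) (ht : t ∈ P) {i : Fin 3} :
    ∀ s ∈ P, InCone i t s → Arrives P t (s, .idle none)
      (19 * (2 * (coneCoord i t - coneCoord i s) +
        min (coneCoord (i + 1) s - coneCoord (i + 1) t)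
          (coneCoord (i + 2) s - coneCoord (i + 2) t))) := by
  refine finset_induction_real P (fun s => - coneCoord i s) _ ?_
  intro s hs ih hts
  have hadv : advance P t (s, .idle none) = _ := idleStep_none_of_inCone_swap hts
  have hflag : idleStep (nbhd P s) t s (some (smallSide i t s))
    = flagStep (nbhd P s) t s i (smallSide i t s) := idleStep_some_of_inCone_swap hts
  obtain ⟨k, hd, hle, hmin⟩ := smallSide_spec i t s
  simp only [hmin] at ih ⊢
  generalize smallSide i t s = j at *
  have hk3 := hd.third_eq
  have hj := hd.rotate
  rw [min_eq_left hle]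
  have cts := hd.inCone.1 hts
  have lts := hts.lt
  have e1 := hd.sum_eq_zero s
  have e2 := hd.sum_eq_zero t
  rcases descend_cases hP hd.1 hs ht hts none with ⟨hnone, hno⟩ |
    ⟨m, hm, hms, hmj, hmk, hmin, r, hr, htrip⟩
  · rw [hnone, Option.getD_none] at hadv
    obtain ⟨h1, h2⟩ := search_result (c := (s, .idle none)) hP hs cts.1 rfl trivial hadv
    by_cases hy : ∃ y, Nearest P j s y ∧ coneCoord j t ≤ coneCoord j y
    · obtain ⟨y, hy, hty⟩ := hy
      obtain ⟨L, hT, hL⟩ := h1 y hy hty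
      rw [newFlag, if_neg hts.not_inCone_swap] at hT
      have cy := hj.inCone.1 hy.2.1
      have hyt : InCone i t y := (hP.eq_or_inCone hd ht hy.1 hty (by linarith)).resolve_left
        (by rintro rfl; linarith)
      refine (hT.arrives rfl rfl (ih y hy.1 (by linarith) hyt)).mono ?_
      have := hy.2.1.dist_le
      have := min_le_left (coneCoord j y - coneCoord j t) (coneCoord k y - coneCoord k t)
      linarith
    · push Not at hy
      obtain ⟨d, L, hT, hds, hdadv, hL⟩ := h2 hy
      -- Failing at once and failing after a return lead to the same next step.
      rw [hflag, or_self, ← hflag] at hdadv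
      have hE : SideEmpty P t j s := by
        intro p hp hsp
        obtain ⟨y, hy'⟩ := exists_nearest hp hsp
        exact (hy'.2.2 p hp hsp).trans_lt (hy y hy')
      -- Let `A ≤ K` be the side extents and `H = A + K` the height. The failed search costs `20A`,
      -- the flagged potential is `H + K = 2H - A`, and the total `38H + A` is within `19(2H + A)`.
      refine (hT.arrives (e := (s, .idle (some j))) hds hdadv
        (arrives_flag hP ht hd s hs hts hE)).mono ?_
      linarith
  · rw [hk3] at hmk
    rw [hr, Option.getD_some] at hadv
    obtain ⟨d, L, hT, hdm, hdadv, hL⟩ := htrip (s, .idle none) rfl trivial hadv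
    have hA : Arrives P t (m, .idle none) (19 * (2 * (coneCoord i t - coneCoord i m) +
        min (coneCoord j m - coneCoord j t) (coneCoord k m - coneCoord k t))) := by
      rcases hP.eq_or_inCone hd ht hm hmj hmk with rfl | htm
      · exact arrives_of_eq hm trivial rfl (by simp)
      · exact ih m hm (neg_lt_neg hms.2.1.lt) htm
    refine (hT.arrives (e := (m, .idle none)) hdm hdadv hA).mono ?_
    have h1 := hms.2.1.dist_le
    have h2 := (hd.inCone.1 hms.2.1).1
    rw [dist_comm] at h1
    have := min_le_left (coneCoord j m - coneCoord j t) (coneCoord k m - coneCoord k t)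
    have := hms.2.1.lt
    linarith

/-- As long as `t` stays in `C_i`, the drop of coordinate `i` pays for each edge. Once `t` is in a
negative cone, the empty triangle just traversed supplies the flag, and the maximum pays for the
height of the flagged routing. -/
lemma arrives_pos (hP : GeneralPosition P) (ht : t ∈ P) {i j k : Fin 3} (hd : Distinct3 i j k) :
    ∀ s ∈ P, InCone i s t → ∀ f, Arrives P t (s, .idle f)
      (19 * ((coneCoord i s - coneCoord i t) +
        max (coneCoord j t - coneCoord j s) (coneCoord k t - coneCoord k s))) := by
  refine finset_induction_real P (coneCoord i) _ ?_
  intro s hs ih hst f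
  have hadv : advance P t (s, .idle f) = _ := idleStep_of_inCone (f := f) hst
  obtain ⟨v, hv⟩ := exists_nearest ht hst
  have htv := hv.2.2 t ht hst
  obtain ⟨L, hT, hL⟩ := (search_result (c := (s, .idle f)) hP hs hst.lt rfl trivial hadv).1 v hv htv
  have hsv := hv.2.1.dist_le
  have cv := hd.inCone.1 hv.2.1
  have ct := hd.inCone.1 hst
  have m1 := le_max_left (coneCoord j t - coneCoord j s) (coneCoord k t - coneCoord k s)
  have m2 := le_max_right (coneCoord j t - coneCoord j s) (coneCoord k t - coneCoord k s)
  by_cases hvt : v = t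
  · subst hvt
    refine (hT.arrives rfl rfl (arrives_of_eq hv.1 trivial rfl le_rfl)).mono ?_
    linarith
  obtain ⟨l, hl | hl⟩ := hP.inCone_cases hv.1 ht hvt
  · have : l = i := by
      by_contra hli
      exact (hl i (Ne.symm hli)).not_ge htv
    subst this
    refine (hT.arrives rfl rfl (ih v hv.1 hv.2.1.lt hl _)).mono ?_
    have : max (coneCoord j t - coneCoord j v) (coneCoord k t - coneCoord k v)
        ≤ max (coneCoord j t - coneCoord j s) (coneCoord k t - coneCoord k s) :=
      max_le_max (by linarith) (by linarith)
    linarith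
  · have hli : i ≠ l := by
      rintro rfl
      exact hl.lt.not_ge htv
    have hex : ∃ k, InCone k t v := ⟨l, hl⟩
    rw [newFlag, if_pos hst, dif_pos hex, hex.choose_spec.index_unique hl] at hT
    have hdl := distinct3_third hli
    -- A vertex of this side region would lie in `C_i` of `s` and be closer than `v`.
    have hE : SideEmpty P t (third i l) v := by
      intro p hp hvp
      by_contra hc
      rw [not_lt] at hc
      obtain ⟨p1, p2⟩ := hdl.rotate.rotate.inCone.1 hvp
      obtain ⟨v1, v2⟩ := hdl.inCone.1 hv.2.1
      obtain ⟨t1, t2⟩ := hdl.inCone.1 hst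
      exact (hv.2.2 p hp (hdl.inCone.2 ⟨by linarith, by linarith⟩)).not_gt p1
    refine (hT.arrives rfl rfl (arrives_flag hP ht hdl.rotate v hv.1 hl hE)).mono ?_
    have hm : coneCoord l t - coneCoord l s ≤
        max (coneCoord j t - coneCoord j s) (coneCoord k t - coneCoord k s) :=
      (hd.forall_ne (Q := fun l => coneCoord l t - coneCoord l s ≤
        max (coneCoord j t - coneCoord j s) (coneCoord k t - coneCoord k s))).2
        ⟨m1, m2⟩ l hli.symm
    have := hv.2.1 l hli.symm
    linarith

end

/-! ### The routing ratios. -/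

theorem mainTheorem8 :
    ∃ (m : ℕ) (A : RoutingAlgorithm 1 m),
      ∀ (P : Finset Plane), GeneralPosition P →
        ∀ u ∈ P, ∀ w ∈ P, (∃ i, w ∈ positiveCone i u) →
          A.DeliversWithin P (GTwelve P) u w (38 * dist u w) ∧
          A.DeliversWithin P (GTwelve P) w u (19 * (5 / Real.sqrt 3) * dist w u) := by
  refine ⟨numUnits, router, fun P hP u hu w hw ⟨i, hi⟩ => ?_⟩
  rw [hP.mem_positiveCone_iff hu hw] at hi
  have hcard : 1 < P.card := Finset.one_lt_card.2 ⟨u, hu, w, hw, hi.ne⟩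
  have hd := distinct3_cyclic i
  have c := hd.inCone.1 hi
  have e1 := hd.sum_eq_zero u
  have e2 := hd.sum_eq_zero w
  have q := dist_sq_eq hd u w
  have hD := dist_nonneg (x := u) (y := w)
  constructor
  · refine (arrives_pos hP hw hd u hu hi none).mono ?_ |>.deliversWithin hcard
    have : (coneCoord i u - coneCoord i w) + max (coneCoord (i + 1) w - coneCoord (i + 1) u)
        (coneCoord (i + 2) w - coneCoord (i + 2) u) ≤ 2 * dist u w := by
      -- For coordinate differences `a ≥ b` the potential is `2a + b`, and `(2a + b)² ≤ 4(a² + ab +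
      -- b²)`.
      refine abs_le_of_sq_le_sq' ?_ (by linarith) |>.2
      rw [mul_pow, q]
      rcases max_cases (coneCoord (i + 1) w - coneCoord (i + 1) u)
        (coneCoord (i + 2) w - coneCoord (i + 2) u) with ⟨h, -⟩ | ⟨h, -⟩ <;> rw [h] <;> nlinarith
    linarith
  · refine (arrives_neg hP hu w hw hi).mono ?_ |>.deliversWithin hcard
    rw [dist_comm w u]
    have h3 : (0 : ℝ) < √3 := by positivity
    have h33 : (√3 : ℝ) ^ 2 = 3 := by norm_num
    have : √3 * (2 * (coneCoord i u - coneCoord i w) +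
        min (coneCoord (i + 1) w - coneCoord (i + 1) u)
          (coneCoord (i + 2) w - coneCoord (i + 2) u)) ≤ 5 * dist u w := by
      refine abs_le_of_sq_le_sq' ?_ (by linarith) |>.2
      rw [mul_pow, mul_pow, q, h33]
      obtain ⟨a, ha⟩ : ∃ a, a = coneCoord (i + 1) w - coneCoord (i + 1) u := ⟨_, rfl⟩
      obtain ⟨b, hb⟩ : ∃ b, b = coneCoord (i + 2) w - coneCoord (i + 2) u := ⟨_, rfl⟩
      rw [show coneCoord i u - coneCoord i w = a + b by linarith, ← ha, ← hb]
      have ha0 : 0 < a := by linarith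
      have hb0 : 0 < b := by linarith
      -- For `a ≤ b`: `25(a² + ab + b²) - 3(3a + 2b)² = (b - a)(13b + 2a)`, with equality on the
      -- bisector.
      rcases min_cases a b with ⟨h, h'⟩ | ⟨h, h'⟩ <;> rw [h] <;> nlinarith
    rw [mul_assoc]
    refine mul_le_mul_of_nonneg_left ?_ (by norm_num)
    rw [div_mul_eq_mul_div, le_div_iff₀ h3]
    linarith
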